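/- Let $n\ge 2$. For a pseudo-Riemannian metric $g_M$ on an $n$-dimensional smooth manifold $M$, let $\Delta_M=\operatorname{tr}_{g_M}\nabla d$ be the Laplace–Beltrami operator, let $K_M$ be the scalar curvature (the metric trace of the Ricci tensor of the Levi-Civita connection, normalized so that $K_{S^n}=n(n-1)$), and let $$\widetilde\Delta_M:=\Delta_M-\frac{n-2}{4(n-1)}K_M$$ be the Yamabe operator on the space $C^\infty(M)$ of smooth complex-valued functions. A local diffeomorphism $\Phi:M\to N$ between $n$-dimensional pseudo-Riemannian manifolds $(M,g_M)$, $(N,g_N)$ is called conformal if $\Phi^*g_N=\Omega^2g_M$ for a positive function $\Omega$ on $M$, its conformal factor. For $\lambda\in\mathbb C$ its twisted pull-back is $$\Phi_\lambda^*:C^\infty(N)\to C^\infty(M),\qquad f\mapsto\Omega^\lambda\,(f\circ\Phi),$$ and $\widetilde{\Phi^*}:=\Phi^*_{(n-2)/2}$. If a group $G$ acts on $M$ so that every $L_h:x\mapsto hx$ is conformal, with $L_h^*g_M=\Omega(h,\cdot)^2g_M$, let $\varpi_{M,\lambda}$ be the representation of $G$ on $C^\infty(M)$ given by $(\varpi_{M,\lambda}(h^{-1})f)(x)=\Omega(h,x)^\lambda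 f(hx)$, and put $\varpi_M:=\varpi_{M,(n-2)/2}$. **Proposition.** Let $(M,g_M)$ and $(N,g_N)$ be pseudo-Riemannian manifolds of dimension $n\ge 2$ and let $\Phi:M\to N$ be a conformal local diffeomorphism with conformal factor $\Omega$. Let groups $G'$ and $G$ (for example Lie groups) act by conformal transformations on $M$ and $N$ respectively, with conformal factors $\Omega_M(h,\cdot)$ $(h\in G')$ and $\Omega_N(h,\cdot)$ $(h\in G)$, and let $i:G'\to G$ be a homomorphism such that $i(h)\,\Phi(x)=\Phi(hx)$ for all $h\in G'$, $x\in M$. Then: 1. For all $h\in G'$ and $x\in M$, $\ \Omega(hx)\,\Omega_M(h,x)=\Omega(x)\,\Omega_N(i(h),\Phi(x))$. 2. For every $\lambda\in\mathbb C$ and $h\in G'$, $\ \Phi_\lambda^*\circ\varpi_{N,\lambda}(i(h))=\varpi_{M,\lambda}(h)\circ\Phi_\lambda^*$. 3. $\widetilde{\Phi^*}$ maps $\operatorname{Ker}\widetilde\Delta_N$ into $\operatorname{Ker}\widetilde\Delta_M$. The group $G$ preserves $\operatorname{Ker}\widetilde\Delta_N$ through $\varpi_N$, the group $G'$ preserves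 $\operatorname{Ker}\widetilde\Delta_M$ through $\varpi_M$, and $\widetilde{\Phi^*}\,\varpi_N(i(h))f=\varpi_M(h)\,\widetilde{\Phi^*}f$ for all $h\in G'$ and $f\in\operatorname{Ker}\widetilde\Delta_N$. 4. If $\Phi$ is a diffeomorphism onto $N$, then $\Phi^{-1}$ is conformal and $(\Phi^{-1})_\lambda^*$ is the two-sided inverse of $\Phi_\lambda^*$ for every $\lambda\in\mathbb C$. In particular $\widetilde{\Phi^*}$ is a bijection from $\operatorname{Ker}\widetilde\Delta_N$ onto $\operatorname{Ker}\widetilde\Delta_M$ with inverse $\widetilde{(\Phi^{-1})^*}$. -/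

import Mathlib

open scoped Manifold ContDiff Bundle

noncomputable section

namespace ConformalGeometry

/-- The model space `ℝⁿ`. -/
abbrev Model (n : ℕ) : Type := EuclideanSpace ℝ (Fin n)

/-! ### Levi-Civita connection, curvature and Laplacian of a metric on an open piece of `ℝⁿ`

A metric is a function `g : ℝⁿ → (ℝⁿ → (ℝⁿ)^*)`, `g y u v` being the product at the point `y` of
the vectors `u` and `v`. All the quantities at `y` depend only on the germ of `g` at `y`. -/

section Local

variable {n : ℕ}

/-- The `i`-th coordinate vector field `∂ᵢ`. -/
def coordVec (i : Fin n) : Model n := EuclideanSpace.single i 1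

/-- The vector `dxⁱ` raised by the bilinear form `b`, that is `∑ⱼ bⁱʲ ∂ⱼ`
(the junk value `0` when `b` is degenerate). -/
def raisedCovec (b : Model n →L[ℝ] Model n →L[ℝ] ℝ) (i : Fin n) : Model n :=
  ContinuousLinearMap.inverse b (EuclideanSpace.proj i)

/-- The trace `∑ᵢⱼ bⁱʲ B(∂ⱼ, ∂ᵢ)` of the bilinear map `B` with respect to `b`. -/
def metricTrace {F : Type*} [AddCommMonoid F] (b : Model n →L[ℝ] Model n →L[ℝ] ℝ)
    (B : Model n → Model n → F) : F :=
  ∑ i, B (raisedCovec b i) (coordVec i)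

/-- The Christoffel symbols `Γ(u, v) = ∇ᵤ v` (constant vector fields `u`, `v`) of the Levi-Civita
connection of `g`, given by the Koszul formula
`2 g(Γ(u, v), w) = D_u g (v, w) + D_v g (u, w) - D_w g (u, v)`. -/
def christoffel (g : Model n → Model n →L[ℝ] Model n →L[ℝ] ℝ) (y u v : Model n) : Model n :=
  ContinuousLinearMap.inverse (g y) ((1 / 2 : ℝ) •
    (fderiv ℝ g y u v + fderiv ℝ g y v u - ((fderiv ℝ g y).flip u).flip v))

/-- The curvature tensor `R(u, v) w = ∇ᵤ ∇ᵥ w - ∇ᵥ ∇ᵤ w`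
(constant vector fields `u`, `v`, `w`, so that `[u, v] = 0`). -/
def curvature (g : Model n → Model n →L[ℝ] Model n →L[ℝ] ℝ) (y u v w : Model n) : Model n :=
  (fderiv ℝ (fun z => christoffel g z v w) y u + christoffel g y u (christoffel g y v w))
    - (fderiv ℝ (fun z => christoffel g z u w) y v + christoffel g y v (christoffel g y u w))

/-- The Ricci tensor: `Ric(v, w)` is the trace of `u ↦ R(u, v) w`. -/
def ricci (g : Model n → Model n →L[ℝ] Model n →L[ℝ] ℝ) (y v w : Model n) : ℝ :=
  ∑ i, (curvature g y (coordVec i) v w) i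

/-- The scalar curvature, the metric trace of the Ricci tensor (positive on round spheres). -/
def localScalarCurvature (g : Model n → Model n →L[ℝ] Model n →L[ℝ] ℝ) (y : Model n) : ℝ :=
  metricTrace (g y) (ricci g y)

/-- The Hessian `∇df (u, v) = D²f (u, v) - df (Γ(u, v))`. -/
def hessian (g : Model n → Model n →L[ℝ] Model n →L[ℝ] ℝ) (f : Model n → ℂ)
    (y u v : Model n) : ℂ :=
  fderiv ℝ (fderiv ℝ f) y u v - fderiv ℝ f y (christoffel g y u v)

/-- The Laplace-Beltrami operator, the metric trace of the Hessian. -/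
def localLaplacian (g : Model n → Model n →L[ℝ] Model n →L[ℝ] ℝ) (f : Model n → ℂ)
    (y : Model n) : ℂ :=
  metricTrace (g y) (hessian g f y)

end Local

/-! ### Pseudo-Riemannian manifolds -/

section Manifolds

variable {n : ℕ}
  {M : Type*} [TopologicalSpace M] [ChartedSpace (Model n) M] [IsManifold (𝓡 n) ∞ M]
  {N : Type*} [TopologicalSpace N] [ChartedSpace (Model n) N] [IsManifold (𝓡 n) ∞ N]

variable (n M) in
/-- A pseudo-Riemannian metric: a smooth field of nondegenerate symmetric bilinear forms on the
tangent spaces. -/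
structure PseudoRiemannianMetric where
  /-- The bilinear form on the tangent space at `x`. -/
  val (x : M) : TangentSpace (𝓡 n) x →L[ℝ] TangentSpace (𝓡 n) x →L[ℝ] ℝ
  symm (x : M) (u v : TangentSpace (𝓡 n) x) : val x u v = val x v u
  nondegenerate (x : M) (u : TangentSpace (𝓡 n) x) (hu : ∀ v, val x u v = 0) : u = 0
  contMDiff : ContMDiff (𝓡 n) ((𝓡 n).prod 𝓘(ℝ, Model n →L[ℝ] Model n →L[ℝ] ℝ)) ∞
    (fun x => Bundle.TotalSpace.mk' (Model n →L[ℝ] Model n →L[ℝ] ℝ)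
      (E := fun x : M => TangentSpace (𝓡 n) x →L[ℝ] TangentSpace (𝓡 n) x →L[ℝ] ℝ) x (val x))

/-- The metric `g` in the preferred chart `φ` at `x`, that is the pull-back of `g` under `φ⁻¹`
(meaningful on the target of `φ`). -/
def PseudoRiemannianMetric.inChart (g : PseudoRiemannianMetric n M) (x : M) (y : Model n) :
    Model n →L[ℝ] Model n →L[ℝ] ℝ :=
  let b : Model n →L[ℝ] Model n →L[ℝ] ℝ := g.val ((extChartAt (𝓡 n) x).symm y)
  let A : Model n →L[ℝ] Model n := mfderiv (𝓡 n) (𝓡 n) (extChartAt (𝓡 n) x).symm y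
  b.bilinearComp A A

/-- The scalar curvature of a pseudo-Riemannian manifold. -/
def scalarCurvature (g : PseudoRiemannianMetric n M) (x : M) : ℝ :=
  localScalarCurvature (g.inChart x) (extChartAt (𝓡 n) x x)

/-- The Laplace-Beltrami operator of a pseudo-Riemannian manifold on complex functions. -/
def laplacian (g : PseudoRiemannianMetric n M) (f : M → ℂ) (x : M) : ℂ :=
  localLaplacian (g.inChart x) (f ∘ (extChartAt (𝓡 n) x).symm) (extChartAt (𝓡 n) x x)

variable (n M) in
/-- The complex vector space `C^∞(M)` of smooth complex-valued functions. -/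
def smoothFunctions : Submodule ℂ (M → ℂ) where
  carrier := {f | ContMDiff (𝓡 n) 𝓘(ℝ, ℂ) ∞ f}
  add_mem' hf hg := ContMDiff.add hf hg
  zero_mem' := contMDiff_const
  smul_mem' _ _ hf := contDiff_const.mul contDiff_id |>.comp_contMDiff hf

theorem contDiffAt_inChart {f : M → ℂ} (hf : f ∈ smoothFunctions n M) (x : M) :
    ContDiffAt ℝ ∞ (f ∘ (extChartAt (𝓡 n) x).symm) (extChartAt (𝓡 n) x x) := by
  have h := (contMDiffAt_iff.1 (ContMDiff.contMDiffAt (x := x) hf)).2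
  rw [modelWithCornersSelf_coe, Set.range_id, contDiffWithinAt_univ, extChartAt_model_space_eq_id] at h
  exact h

theorem hessian_add {g : Model n → Model n →L[ℝ] Model n →L[ℝ] ℝ} {f₁ f₂ : Model n → ℂ}
    {y : Model n} (h₁ : ContDiffAt ℝ ∞ f₁ y) (h₂ : ContDiffAt ℝ ∞ f₂ y) (u v : Model n) :
    hessian g (f₁ + f₂) y u v = hessian g f₁ y u v + hessian g f₂ y u v := by
  have e : fderiv ℝ (f₁ + f₂) =ᶠ[nhds y] fderiv ℝ f₁ + fderiv ℝ f₂ := by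
    filter_upwards [(h₁.of_le (m := 1) (by norm_cast)).eventually (by simp),
      (h₂.of_le (m := 1) (by norm_cast)).eventually (by simp)] with z a b
    exact fderiv_add (a.differentiableAt one_ne_zero) (b.differentiableAt one_ne_zero)
  have d₁ := (h₁.fderiv_right (m := 1) (by norm_cast)).differentiableAt one_ne_zero
  have d₂ := (h₂.fderiv_right (m := 1) (by norm_cast)).differentiableAt one_ne_zero
  unfold hessian
  rw [e.fderiv_eq, e.self_of_nhds, fderiv_add d₁ d₂]
  simp only [Pi.add_apply, add_apply]
  ring

theorem hessian_smul {g : Model n → Model n →L[ℝ] Model n →L[ℝ] ℝ} {f : Model n → ℂ}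
    {y : Model n} (h : ContDiffAt ℝ ∞ f y) (c : ℂ) (u v : Model n) :
    hessian g (c • f) y u v = c * hessian g f y u v := by
  have e : fderiv ℝ (c • f) =ᶠ[nhds y] c • fderiv ℝ f := by
    filter_upwards [(h.of_le (m := 1) (by norm_cast)).eventually (by simp)] with z a
    exact fderiv_const_smul (a.differentiableAt one_ne_zero) c
  have d := (h.fderiv_right (m := 1) (by norm_cast)).differentiableAt one_ne_zero
  unfold hessian
  rw [e.fderiv_eq, e.self_of_nhds, fderiv_const_smul d c]
  simp only [Pi.smul_apply, smul_apply, smul_eq_mul]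
  ring

/-- The Yamabe operator `Δ - (n - 2) / (4 (n - 1)) K` on smooth functions. -/
def yamabe (g : PseudoRiemannianMetric n M) : smoothFunctions n M →ₗ[ℂ] (M → ℂ) where
  toFun f x := laplacian g f x
    - (((n : ℝ) - 2) / (4 * ((n : ℝ) - 1)) * scalarCurvature g x : ℝ) * (f : M → ℂ) x
  map_add' f₁ f₂ := by
    funext x
    have := fun u v => hessian_add (g := g.inChart x)
      (contDiffAt_inChart f₁.2 x) (contDiffAt_inChart f₂.2 x) u v
    have e : laplacian g (f₁ + f₂ : smoothFunctions n M) x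
        = laplacian g f₁ x + laplacian g f₂ x := by
      simp only [laplacian, localLaplacian, metricTrace, ← Finset.sum_add_distrib]
      exact Finset.sum_congr rfl fun i _ => this _ _
    rw [e]
    simp only [Pi.add_apply, Submodule.coe_add]
    ring
  map_smul' c f := by
    funext x
    have := fun u v => hessian_smul (g := g.inChart x) (contDiffAt_inChart f.2 x) c u v
    have e : laplacian g (c • f : smoothFunctions n M) x = c * laplacian g f x := by
      simp only [laplacian, localLaplacian, metricTrace, Finset.mul_sum]
      exact Finset.sum_congr rfl fun i _ => this _ _
    rw [e]
    simp only [Pi.smul_apply, Submodule.coe_smul, smul_eq_mul, RingHom.id_apply]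
    ring

/-- The kernel of the Yamabe operator in `C^∞(M)`. -/
def yamabeKer (g : PseudoRiemannianMetric n M) : Submodule ℂ (smoothFunctions n M) :=
  LinearMap.ker (yamabe g)

/-! ### Conformal maps and twisted pull-backs -/

/-- `Ω` is a conformal factor of `Φ`: it is positive and `Φ^* g_N = Ω² g_M`. -/
def IsConformalFactor (gM : PseudoRiemannianMetric n M) (gN : PseudoRiemannianMetric n N)
    (Φ : M → N) (Ω : M → ℝ) : Prop :=
  (∀ x, 0 < Ω x) ∧ ∀ (x : M) (u v : TangentSpace (𝓡 n) x),
    gN.val (Φ x) (mfderiv (𝓡 n) (𝓡 n) Φ x u) (mfderiv (𝓡 n) (𝓡 n) Φ x v)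
      = Ω x ^ 2 * gM.val x u v

/-- A conformal map: a local diffeomorphism that has a conformal factor. -/
structure IsConformalMap (gM : PseudoRiemannianMetric n M) (gN : PseudoRiemannianMetric n N)
    (Φ : M → N) : Prop where
  isLocalDiffeomorph : IsLocalDiffeomorph (𝓡 n) (𝓡 n) ∞ Φ
  exists_factor : ∃ Ω : M → ℝ, IsConformalFactor gM gN Φ Ω

/-- The conformal factor of a conformal map (it is unique when `n ≥ 1`). -/
def IsConformalMap.factor {gM : PseudoRiemannianMetric n M} {gN : PseudoRiemannianMetric n N}
    {Φ : M → N} (hΦ : IsConformalMap gM gN Φ) : M → ℝ :=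
  hΦ.exists_factor.choose

theorem IsConformalMap.isConformalFactor {gM : PseudoRiemannianMetric n M}
    {gN : PseudoRiemannianMetric n N} {Φ : M → N} (hΦ : IsConformalMap gM gN Φ) :
    IsConformalFactor gM gN Φ hΦ.factor :=
  hΦ.exists_factor.choose_spec

theorem PseudoRiemannianMetric.exists_ne_zero [NeZero n] (g : PseudoRiemannianMetric n M) (x : M) :
    ∃ u v : TangentSpace (𝓡 n) x, g.val x u v ≠ 0 := by
  by_contra! h
  have : (EuclideanSpace.single (0 : Fin n) (1 : ℝ) : Model n) = 0 :=
    g.nondegenerate x (EuclideanSpace.single (0 : Fin n) (1 : ℝ) : Model n) (h _)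
  simpa using congrArg (fun w : Model n => w 0) this

theorem IsConformalFactor.unique [NeZero n] {gM : PseudoRiemannianMetric n M}
    {gN : PseudoRiemannianMetric n N} {Φ : M → N} {Ω₁ Ω₂ : M → ℝ}
    (h₁ : IsConformalFactor gM gN Φ Ω₁) (h₂ : IsConformalFactor gM gN Φ Ω₂) : Ω₁ = Ω₂ := by
  funext x
  obtain ⟨u, v, huv⟩ := gM.exists_ne_zero x
  have h := mul_right_cancel₀ huv ((h₁.2 x u v).symm.trans (h₂.2 x u v))
  exact (pow_left_inj₀ (h₁.1 x).le (h₂.1 x).le two_ne_zero).1 h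

theorem IsConformalFactor.contMDiff [NeZero n] {gM : PseudoRiemannianMetric n M}
    {gN : PseudoRiemannianMetric n N} {Φ : M → N} {Ω : M → ℝ}
    (hΦ : ContMDiff (𝓡 n) (𝓡 n) ∞ Φ) (h : IsConformalFactor gM gN Φ Ω) :
    ContMDiff (𝓡 n) 𝓘(ℝ, ℝ) ∞ Ω := by
  intro x₀
  obtain ⟨u, v, huv⟩ := gM.exists_ne_zero x₀
  set U := FiberBundle.extend (E := fun x : M => TangentSpace (𝓡 n) x) (Model n) u with hU
  set V := FiberBundle.extend (E := fun x : M => TangentSpace (𝓡 n) x) (Model n) v with hV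
  have sU : ContMDiffAt (𝓡 n) ((𝓡 n).prod 𝓘(ℝ, Model n)) ∞
      (fun x => Bundle.TotalSpace.mk' (Model n) x (U x)) x₀ :=
    FiberBundle.contMDiffAt_extend (𝓡 n) (Model n) u
  have sV : ContMDiffAt (𝓡 n) ((𝓡 n).prod 𝓘(ℝ, Model n)) ∞
      (fun x => Bundle.TotalSpace.mk' (Model n) x (V x)) x₀ :=
    FiberBundle.contMDiffAt_extend (𝓡 n) (Model n) v
  have sM : ContMDiffAt (𝓡 n) 𝓘(ℝ, ℝ) ∞ (fun x => gM.val x (U x) (V x)) x₀ := by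
    have := ContMDiffAt.clm_bundle_apply₂ (F₁ := Model n) (F₂ := Model n) (F₃ := ℝ)
      (E₃ := Bundle.Trivial M ℝ) (gM.contMDiff x₀) sU sV
    simp only [Bundle.contMDiffAt_totalSpace] at this
    exact this.2
  have sN : ContMDiffAt (𝓡 n) 𝓘(ℝ, ℝ) ∞ (fun x => gN.val (Φ x)
      (mfderiv (𝓡 n) (𝓡 n) Φ x (U x)) (mfderiv (𝓡 n) (𝓡 n) Φ x (V x))) x₀ := by
    have t := hΦ.contMDiff_tangentMap (m := ∞) (by norm_cast)
    have tU := (t.contMDiffAt (x := ⟨x₀, U x₀⟩)).comp x₀ sU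
    have tV := (t.contMDiffAt (x := ⟨x₀, V x₀⟩)).comp x₀ sV
    have := ContMDiffAt.clm_bundle_apply₂ (F₁ := Model n) (F₂ := Model n) (F₃ := ℝ)
      (E₃ := Bundle.Trivial N ℝ) ((gN.contMDiff (Φ x₀)).comp x₀ (hΦ x₀)) tU tV
    simp only [Bundle.contMDiffAt_totalSpace] at this
    exact this.2
  have ne : gM.val x₀ (U x₀) (V x₀) ≠ 0 := by simpa [hU, hV] using huv
  have ev : ∀ᶠ x in nhds x₀, gM.val x (U x) (V x) ≠ 0 := sM.continuousAt.eventually_ne ne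
  have e : (fun x => √(gN.val (Φ x) (mfderiv (𝓡 n) (𝓡 n) Φ x (U x))
      (mfderiv (𝓡 n) (𝓡 n) Φ x (V x)) / gM.val x (U x) (V x))) =ᶠ[nhds x₀] Ω := by
    filter_upwards [ev] with x hx
    rw [h.2, mul_div_cancel_right₀ _ hx, Real.sqrt_sq (h.1 x).le]
  refine ContMDiffAt.congr_of_eventuallyEq ?_ e.symm
  have q := sN.div₀ sM ne
  refine ContDiffAt.comp_contMDiffAt (g := Real.sqrt) (Real.contDiffAt_sqrt ?_) q
  have := h.2 x₀ (U x₀) (V x₀)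
  change gN.val (Φ x₀) _ _ / gM.val x₀ _ _ ≠ 0
  rw [this, mul_div_cancel_right₀ _ ne]
  exact (pow_pos (h.1 x₀) 2).ne'

theorem contMDiff_ofReal_cpow {Ω : M → ℝ} (hΩ : ContMDiff (𝓡 n) 𝓘(ℝ, ℝ) ∞ Ω)
    (pos : ∀ x, 0 < Ω x) (lam : ℂ) :
    ContMDiff (𝓡 n) 𝓘(ℝ, ℂ) ∞ (fun x => (Ω x : ℂ) ^ lam) := by
  intro x
  have h : ContDiffAt ℝ ∞ (fun t : ℝ => Complex.exp ((Real.log t : ℂ) * lam)) (Ω x) := by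
    have := Real.contDiffAt_log (n := ∞) |>.2 (pos x).ne'
    have := (Complex.ofRealCLM.contDiff (n := ∞)).contDiffAt.comp (Ω x) this
    exact (this.mul contDiffAt_const).cexp
  refine (h.comp_contMDiffAt (hΩ x)).congr_of_eventuallyEq (Filter.Eventually.of_forall fun z => ?_)
  simp only [Function.comp_apply]
  rw [Complex.cpow_def_of_ne_zero (by exact_mod_cast (pos z).ne'), Complex.ofReal_log (pos z).le]

/-- The twisted pull-back `Φ_λ^* : C^∞(N) → C^∞(M)`, `f ↦ Ω^λ (f ∘ Φ)`. -/
def twistedPullback [NeZero n] {gM : PseudoRiemannianMetric n M} {gN : PseudoRiemannianMetric n N}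
    {Φ : M → N} (hΦ : IsConformalMap gM gN Φ) (lam : ℂ) :
    smoothFunctions n N →ₗ[ℂ] smoothFunctions n M where
  toFun f := ⟨fun x => (hΦ.factor x : ℂ) ^ lam * (f : N → ℂ) (Φ x),
    (contDiff_fst.mul contDiff_snd).comp_contMDiff ((contMDiff_ofReal_cpow
      (hΦ.isConformalFactor.contMDiff hΦ.isLocalDiffeomorph.contMDiff)
      hΦ.isConformalFactor.1 lam).prodMk_space
      (ContMDiff.comp (I' := 𝓡 n) (g := (f : N → ℂ)) f.2 hΦ.isLocalDiffeomorph.contMDiff))⟩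
  map_add' f₁ f₂ := by
    ext x
    simp [mul_add]
  map_smul' c f := by
    ext x
    simp [mul_left_comm]

/-! ### Conformal actions -/

variable {G : Type*} [Group G] [MulAction G M]

variable (G) in
/-- The group `G` acts on `M` by conformal transformations. -/
def IsConformalAction (g : PseudoRiemannianMetric n M) : Prop :=
  ∀ h : G, IsConformalMap g g (fun x : M => h • x)

/-- The conformal factor `Ω(h, x)` of a conformal action: `L_h^* g = Ω(h, ·)² g`. -/
def IsConformalAction.factor {g : PseudoRiemannianMetric n M} (hG : IsConformalAction G g)
    (h : G) (x : M) : ℝ :=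
  (hG h).factor x

theorem IsConformalAction.factor_one [NeZero n] {g : PseudoRiemannianMetric n M}
    (hG : IsConformalAction G g) (x : M) : hG.factor 1 x = 1 := by
  have h : IsConformalFactor g g (fun x : M => (1 : G) • x) (fun _ => 1) := by
    refine ⟨fun _ => one_pos, fun x u v => ?_⟩
    have e : (fun x : M => (1 : G) • x) = id := funext fun x => one_smul G x
    have : ∀ Ψ : M → M, Ψ = id → g.val (Ψ x) (mfderiv (𝓡 n) (𝓡 n) Ψ x u)
        (mfderiv (𝓡 n) (𝓡 n) Ψ x v) = 1 ^ 2 * g.val x u v := by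
      rintro _ rfl
      rw [mfderiv_id, one_pow, one_mul]
      rfl
    exact this _ e
  exact congrFun ((hG 1).isConformalFactor.unique h) x

theorem IsConformalAction.factor_mul [NeZero n] {g : PseudoRiemannianMetric n M}
    (hG : IsConformalAction G g) (h₁ h₂ : G) (x : M) :
    hG.factor (h₁ * h₂) x = hG.factor h₁ (h₂ • x) * hG.factor h₂ x := by
  have h : IsConformalFactor g g (fun x : M => (h₁ * h₂) • x)
      (fun x => hG.factor h₁ (h₂ • x) * hG.factor h₂ x) := by
    refine ⟨fun x => mul_pos ((hG h₁).isConformalFactor.1 _) ((hG h₂).isConformalFactor.1 _),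
      fun x u v => ?_⟩
    have e : (fun x : M => (h₁ * h₂) • x) = (fun x : M => h₁ • x) ∘ (fun x : M => h₂ • x) :=
      funext fun x => mul_smul h₁ h₂ x
    have d : ∀ h : G, MDifferentiable (𝓡 n) (𝓡 n) (fun x : M => h • x) := fun h =>
      (hG h).isLocalDiffeomorph.contMDiff.mdifferentiable (by simp)
    have : ∀ Ψ : M → M, Ψ = (fun x : M => h₁ • x) ∘ (fun x : M => h₂ • x) →
        g.val (Ψ x) (mfderiv (𝓡 n) (𝓡 n) Ψ x u) (mfderiv (𝓡 n) (𝓡 n) Ψ x v)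
          = (hG.factor h₁ (h₂ • x) * hG.factor h₂ x) ^ 2 * g.val x u v := by
      rintro _ rfl
      rw [mfderiv_comp x (d h₁ (h₂ • x)) (d h₂ x)]
      refine ((hG h₁).isConformalFactor.2 (h₂ • x) _ _).trans ?_
      refine (congrArg _ ((hG h₂).isConformalFactor.2 x u v)).trans ?_
      rw [← mul_assoc, ← mul_pow]
      rfl
    exact this _ e
  exact congrFun ((hG (h₁ * h₂)).isConformalFactor.unique h) x

/-- The representation `ϖ_λ` of `G` on `C^∞(M)`: `(ϖ_λ(h⁻¹) f)(x) = Ω(h, x)^λ f(h x)`, so that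
`ϖ_λ(h)` is the twisted pull-back by the action of `h⁻¹`. -/
def varpi [NeZero n] {g : PseudoRiemannianMetric n M} (hG : IsConformalAction G g) (lam : ℂ) :
    Representation ℂ G (smoothFunctions n M) where
  toFun h := twistedPullback (hG h⁻¹) lam
  map_one' := by
    ext f x
    have e : (hG (1 : G)⁻¹).factor x = 1 := by
      have := hG.factor_one x
      rwa [← inv_one] at this
    change ((hG (1 : G)⁻¹).factor x : ℂ) ^ lam * (f : M → ℂ) ((1 : G)⁻¹ • x) = (f : M → ℂ) x
    rw [e]
    simp
  map_mul' h₁ h₂ := by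
    ext f x
    have e : (hG (h₁ * h₂)⁻¹).factor x
        = (hG h₂⁻¹).factor (h₁⁻¹ • x) * (hG h₁⁻¹).factor x := by
      have := hG.factor_mul h₂⁻¹ h₁⁻¹ x
      rwa [← mul_inv_rev] at this
    change ((hG (h₁ * h₂)⁻¹).factor x : ℂ) ^ lam * (f : M → ℂ) ((h₁ * h₂)⁻¹ • x)
      = ((hG h₁⁻¹).factor x : ℂ) ^ lam * (((hG h₂⁻¹).factor (h₁⁻¹ • x) : ℂ) ^ lam
        * (f : M → ℂ) (h₂⁻¹ • h₁⁻¹ • x))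
    rw [e, mul_inv_rev, mul_smul, Complex.ofReal_mul,
      Complex.mul_cpow_ofReal_nonneg ((hG h₂⁻¹).isConformalFactor.1 _).le
        ((hG h₁⁻¹).isConformalFactor.1 _).le]
    ring

end Manifolds

end ConformalGeometry

end

open scoped Manifold ContDiff Bundle

noncomputable section

set_option maxSynthPendingDepth 3

/-! The algebraic claims rest on the uniqueness of conformal factors. If two composites of conformal
maps are the same map, the chain rule gives it two factors, which must agree
(`IsConformalMap.factor_comp_eq`). The square formed by Φ, L_h and L_{i(h)} yields the identity
between factors. The square for h⁻¹, raised to the power λ, yields the intertwining relation,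
because complex powers are multiplicative on positive reals. The identity Φ ∘ Φ⁻¹ = id yields the
inverse in the same way (`twistedPullback_comp_eq_id`).

The analytic content is conformal covariance (`yamabe_twistedPullback`): at each point, the Yamabe
operator applied to the critical twisted pull-back of f is a scalar multiple of the Yamabe operator
of f at the image point. The operators of the representations are themselves twisted pull-backs, so
every statement on kernels follows from this one fact.

Covariance is proved in charts. Write the pulled-back metric as h = Ω² g = e^{2φ} g. The map is a
local isometry from h to the target metric, and scalar curvature and Laplacian are natural under
local isometries (`IsPullbackOn.localScalarCurvature_eq`, `IsPullbackOn.localLaplacian_eq`). There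
remains the passage from g to h on a fixed domain: K_h = e^{-2φ} (K_g - 2(n-1) Δφ - (n-2)(n-1)
|∇φ|²), Δ_h p = e^{-2φ} (Δ_g p + (n-2) dp(∇φ)), Δ_g(e^{μφ} p) = e^{μφ} (Δ_g p + 2μ dp(∇φ) + (μ Δφ +
μ² |∇φ|²) p). For μ = (n-2)/2 and the Yamabe coefficient (n-2)/(4(n-1)) all terms in φ match
(`IsConformalOn.localYamabe_eq`). -/

namespace ConformalGeometry

/-! ### Linear algebra of nondegenerate forms and traces -/

section Algebra

variable {n : ℕ}

/-- Nondegeneracy of a bilinear form on `ℝⁿ`. -/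
def Nondeg (b : Model n →L[ℝ] Model n →L[ℝ] ℝ) : Prop :=
  ∀ u, (∀ v, b u v = 0) → u = 0

/-- Injectivity and equality of dimensions give invertibility. This rules out the default value 0 of
`ContinuousLinearMap.inverse` wherever an index is raised. -/
theorem Nondeg.isInvertible {b : Model n →L[ℝ] Model n →L[ℝ] ℝ} (hb : Nondeg b) :
    b.IsInvertible := by
  have inj : Function.Injective b.toLinearMap := by
    rw [← LinearMap.ker_eq_bot, LinearMap.ker_eq_bot']
    intro u hu
    exact hb u fun v => congrArg (fun l : Model n →L[ℝ] ℝ => l v) hu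
  have dim : Module.finrank ℝ (Model n) = Module.finrank ℝ (Model n →L[ℝ] ℝ) := by
    rw [(LinearMap.toContinuousLinearMap (𝕜 := ℝ) (E := Model n) (F' := ℝ)).symm.finrank_eq,
      Module.finrank_linearMap, Module.finrank_self, mul_one]
  refine ⟨(LinearEquiv.ofInjectiveOfFinrankEq b.toLinearMap inj dim).toContinuousLinearEquiv, ?_⟩
  ext u v
  rfl

theorem Nondeg.apply_inverse {b : Model n →L[ℝ] Model n →L[ℝ] ℝ} (hb : Nondeg b)
    (l : Model n →L[ℝ] ℝ) : b (ContinuousLinearMap.inverse b l) = l :=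
  congrArg (fun T => T l) hb.isInvertible.self_comp_inverse

theorem Nondeg.ext {b : Model n →L[ℝ] Model n →L[ℝ] ℝ} (hb : Nondeg b) {u v : Model n}
    (h : ∀ w, b u w = b v w) : u = v :=
  sub_eq_zero.1 (hb _ fun w => by simp [h])

theorem Nondeg.raisedCovec_apply {b : Model n →L[ℝ] Model n →L[ℝ] ℝ} (hb : Nondeg b)
    (i : Fin n) (v : Model n) : b (raisedCovec b i) v = v i := by
  rw [raisedCovec, hb.apply_inverse]
  rfl

theorem sum_smul_coordVec (v : Model n) : ∑ i, v i • coordVec i = v := by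
  simpa [coordVec] using (EuclideanSpace.basisFun (Fin n) ℝ).sum_repr v

/-- The trace of an endomorphism of `ℝⁿ`. -/
def endTrace : (Model n →L[ℝ] Model n) →ₗ[ℝ] ℝ :=
  LinearMap.trace ℝ (Model n) ∘ₗ ContinuousLinearMap.coeLM ℝ

theorem endTrace_eq_sum (A : Model n →L[ℝ] Model n) : endTrace A = ∑ i, A (coordVec i) i := by
  rw [endTrace, LinearMap.comp_apply, LinearMap.trace_eq_matrix_trace ℝ
    (EuclideanSpace.basisFun (Fin n) ℝ).toBasis, Matrix.trace]
  refine Finset.sum_congr rfl fun i _ => ?_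
  simp [LinearMap.toMatrix_apply, coordVec]

theorem endTrace_id : endTrace (ContinuousLinearMap.id ℝ (Model n)) = n := by
  simp [endTrace]

theorem endTrace_smulRight (l : Model n →L[ℝ] ℝ) (v : Model n) :
    endTrace (l.smulRight v) = l v :=
  LinearMap.trace_smulRight l.toLinearMap v

theorem endTrace_conj (A : Model n ≃L[ℝ] Model n) (S T : Model n →L[ℝ] Model n)
    (h : ∀ u, A (S u) = T (A u)) : endTrace S = endTrace T := by
  have e : T.toLinearMap = A.toLinearEquiv.conj S.toLinearMap := by
    ext1 u
    obtain ⟨v, rfl⟩ := A.surjective u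
    simpa [LinearEquiv.conj_apply] using (h v).symm
  change LinearMap.trace ℝ _ S.toLinearMap = LinearMap.trace ℝ _ T.toLinearMap
  rw [e, LinearMap.trace_conj']

theorem metricTrace_add {F : Type*} [AddCommMonoid F] (b : Model n →L[ℝ] Model n →L[ℝ] ℝ)
    (B C : Model n → Model n → F) :
    metricTrace b (fun u v => B u v + C u v) = metricTrace b B + metricTrace b C :=
  Finset.sum_add_distrib

theorem metricTrace_mul_left {F : Type*} [NonUnitalNonAssocSemiring F]
    (b : Model n →L[ℝ] Model n →L[ℝ] ℝ) (c : F) (B : Model n → Model n → F) :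
    metricTrace b (fun u v => c * B u v) = c * metricTrace b B :=
  Finset.mul_sum .. |>.symm

theorem metricTrace_mul_right {F : Type*} [NonUnitalNonAssocSemiring F]
    (b : Model n →L[ℝ] Model n →L[ℝ] ℝ) (c : F) (B : Model n → Model n → F) :
    metricTrace b (fun u v => B u v * c) = metricTrace b B * c :=
  Finset.sum_mul .. |>.symm

theorem metricTrace_ofReal (b : Model n →L[ℝ] Model n →L[ℝ] ℝ) (B : Model n → Model n → ℝ) :
    metricTrace b (fun u v => (B u v : ℂ)) = (metricTrace b B : ℝ) := by
  simp [metricTrace]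

theorem Nondeg.metricTrace_self {b : Model n →L[ℝ] Model n →L[ℝ] ℝ} (hb : Nondeg b) :
    metricTrace b (fun u v => b u v) = n := by
  simp [metricTrace, hb.raisedCovec_apply, coordVec]

theorem Nondeg.metricTrace_tensor_left {F : Type*} [NormedAddCommGroup F] [NormedSpace ℝ F]
    {b : Model n →L[ℝ] Model n →L[ℝ] ℝ} (hb : Nondeg b) (hs : ∀ u v, b u v = b v u)
    (X : Model n) (l : Model n →L[ℝ] F) :
    metricTrace b (fun u v => b X u • l v) = l X := by
  simp only [metricTrace, hs X, hb.raisedCovec_apply, ← map_smul, ← map_sum, sum_smul_coordVec]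

theorem Nondeg.metricTrace_tensor_right {F : Type*} [NormedAddCommGroup F] [NormedSpace ℝ F]
    {b : Model n →L[ℝ] Model n →L[ℝ] ℝ} (hb : Nondeg b)
    (X : Model n) (l : Model n →L[ℝ] F) :
    metricTrace b (fun u v => b X v • l u) = l X := by
  simp only [metricTrace, ← map_smul, ← map_sum]
  congr 1
  -- What is left is that X is the sum of the raised covectors dxⁱ weighted by b(X, ∂ᵢ); it is
  -- checked by pairing with w.
  refine hb.ext fun w => ?_
  conv_rhs => rw [← sum_smul_coordVec w]
  simp only [map_sum, map_smul, _root_.sum_apply, _root_.smul_apply,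
    hb.raisedCovec_apply, smul_eq_mul]
  exact Finset.sum_congr rfl fun _ _ => mul_comm _ _

/-- Raising one index of a symmetric form gives an endomorphism with the same trace. This lets the
Laplacian of φ be handled as an endomorphism trace. -/
theorem Nondeg.metricTrace_operator {b : Model n →L[ℝ] Model n →L[ℝ] ℝ} (hb : Nondeg b)
    (hs : ∀ u v, b u v = b v u) {B : Model n → Model n → ℝ} (hB : ∀ u v, B u v = B v u)
    (S : Model n →L[ℝ] Model n) (hS : ∀ u v, b (S u) v = B u v) :
    metricTrace b B = endTrace S := by
  rw [endTrace_eq_sum, metricTrace]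
  refine Finset.sum_congr rfl fun i _ => ?_
  rw [hB, ← hS, hs, hb.raisedCovec_apply]

theorem Nondeg.smul {b : Model n →L[ℝ] Model n →L[ℝ] ℝ} (hb : Nondeg b) {c : ℝ} (hc : c ≠ 0) :
    Nondeg (c • b) := fun u hu => hb u fun v => by simpa [hc] using hu v

theorem Nondeg.metricTrace_smul_metric {F : Type*} [NormedAddCommGroup F] [NormedSpace ℝ F]
    {b : Model n →L[ℝ] Model n →L[ℝ] ℝ} (hb : Nondeg b) {c : ℝ} (hc : c ≠ 0)
    (B : Model n →L[ℝ] Model n →L[ℝ] F) :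
    metricTrace (c • b) (fun u v => B u v) = c⁻¹ • metricTrace b (fun u v => B u v) := by
  simp only [metricTrace, Finset.smul_sum]
  refine Finset.sum_congr rfl fun i _ => ?_
  have : raisedCovec (c • b) i = c⁻¹ • raisedCovec b i := by
    refine (hb.smul hc).ext fun w => ?_
    rw [(hb.smul hc).raisedCovec_apply]
    simp [hb.raisedCovec_apply, hc]
  rw [this]
  simp

theorem Nondeg.bilinearComp {b : Model n →L[ℝ] Model n →L[ℝ] ℝ} (hb : Nondeg b)
    (A : Model n ≃L[ℝ] Model n) :
    Nondeg (b.bilinearComp (A : Model n →L[ℝ] Model n) (A : Model n →L[ℝ] Model n)) := by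
  intro u hu
  rw [← A.map_eq_zero_iff]
  refine hb _ fun v => ?_
  simpa using hu (A.symm v)

/-- The metric trace does not depend on the basis, although `metricTrace` is defined through the
standard one. This is the linear part of naturality. -/
theorem Nondeg.metricTrace_bilinearComp {F : Type*} [NormedAddCommGroup F] [NormedSpace ℝ F]
    {b : Model n →L[ℝ] Model n →L[ℝ] ℝ} (hb : Nondeg b) (A : Model n ≃L[ℝ] Model n)
    (B : Model n →L[ℝ] Model n →L[ℝ] F) :
    metricTrace (b.bilinearComp (A : Model n →L[ℝ] Model n) (A : Model n →L[ℝ] Model n))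
      (fun u v => B (A u) (A v)) = metricTrace b (fun u v => B u v) := by
  have hb' := hb.bilinearComp A
  set b' := b.bilinearComp (A : Model n →L[ℝ] Model n) (A : Model n →L[ℝ] Model n) with hbA
  -- A sends the covectors raised by the pulled-back form to vectors whose combinations, with the
  -- matrix entries of A, are the covectors raised by b. Pairing with A w turns this into the
  -- expansion of (A w)ⱼ.
  have key : ∀ j, ∑ i, (A (coordVec i) j) • A (raisedCovec b' i) = raisedCovec b j := by
    intro j
    refine hb.ext fun v => ?_
    obtain ⟨w, rfl⟩ := A.surjective v
    have e : ∀ i, b (A (raisedCovec b' i)) (A w) = w i := hb'.raisedCovec_apply (v := w)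
    rw [hb.raisedCovec_apply]
    simp only [map_sum, map_smul, _root_.sum_apply, _root_.smul_apply, e]
    conv_rhs => rw [← sum_smul_coordVec w]
    simp [mul_comm]
  simp only [metricTrace]
  calc ∑ i, B (A (raisedCovec b' i)) (A (coordVec i))
      = ∑ i, ∑ j, B (A (coordVec i) j • A (raisedCovec b' i)) (coordVec j) := by
        refine Finset.sum_congr rfl fun i _ => ?_
        conv_lhs => rw [← sum_smul_coordVec (A (coordVec i))]
        simp
    _ = ∑ j, B (raisedCovec b j) (coordVec j) := by
        rw [Finset.sum_comm]
        refine Finset.sum_congr rfl fun j _ => ?_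
        rw [← key j, map_sum, _root_.sum_apply]

end Algebra

/-! ### The trilinear form of the Koszul formula -/

section Koszul

variable {E : Type*} [NormedAddCommGroup E] [NormedSpace ℝ E]

/-- The trilinear form `(u, v, w) ↦ T u v w + T v u w - T w u v` of the Koszul formula. -/
def koszulForm (T : E →L[ℝ] E →L[ℝ] E →L[ℝ] ℝ) : E →L[ℝ] E →L[ℝ] E →L[ℝ] ℝ :=
  T + T.flip - (ContinuousLinearMap.flipₗᵢ ℝ E E ℝ).toContinuousLinearEquiv.toContinuousLinearMap
    ∘L T.flip

end Koszul

/-! ### Levi-Civita connection and curvature on open subsets of ℝⁿ -/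

section Connection

variable {n : ℕ}

/-- A smooth pseudo-Riemannian metric on an open subset of `ℝⁿ`. -/
structure IsMetricOn (g : Model n → Model n →L[ℝ] Model n →L[ℝ] ℝ) (U : Set (Model n)) :
    Prop where
  isOpen : IsOpen U
  symm : ∀ z ∈ U, ∀ u v, g z u v = g z v u
  nondeg : ∀ z ∈ U, Nondeg (g z)
  contDiffOn : ContDiffOn ℝ ∞ g U

/-- The Christoffel symbols as a bilinear map. -/
def christoffelMap (g : Model n → Model n →L[ℝ] Model n →L[ℝ] ℝ) (y : Model n) :
    Model n →L[ℝ] Model n →L[ℝ] Model n :=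
  (ContinuousLinearMap.compL ℝ (Model n) (Model n →L[ℝ] ℝ) (Model n)
    (ContinuousLinearMap.inverse (g y))) ∘L ((1 / 2 : ℝ) • koszulForm (fderiv ℝ g y))

@[simp]
theorem christoffelMap_apply (g : Model n → Model n →L[ℝ] Model n →L[ℝ] ℝ) (y u v : Model n) :
    christoffelMap g y u v = christoffel g y u v := rfl

variable {g : Model n → Model n →L[ℝ] Model n →L[ℝ] ℝ} {U : Set (Model n)} {y : Model n}

theorem IsMetricOn.contDiffAt (hg : IsMetricOn g U) (hy : y ∈ U) : ContDiffAt ℝ ∞ g y :=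
  hg.contDiffOn.contDiffAt (hg.isOpen.mem_nhds hy)

theorem IsMetricOn.differentiableAt (hg : IsMetricOn g U) (hy : y ∈ U) :
    DifferentiableAt ℝ g y := (hg.contDiffAt hy).differentiableAt (by simp)

theorem IsMetricOn.koszul (hg : IsMetricOn g U) (hy : y ∈ U) (u v w : Model n) :
    g y (christoffel g y u v) w
      = (fderiv ℝ g y u v w + fderiv ℝ g y v u w - fderiv ℝ g y w u v) / 2 := by
  rw [christoffel, (hg.nondeg y hy).apply_inverse]
  simp
  ring

/-- The symmetry of g holds on a whole neighbourhood, so it can be differentiated. -/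
theorem IsMetricOn.fderiv_symm (hg : IsMetricOn g U) (hy : y ∈ U) (u v w : Model n) :
    fderiv ℝ g y u v w = fderiv ℝ g y u w v := by
  have d := (hg.differentiableAt hy).hasFDerivAt
  have d₁ := (d.clm_apply (hasFDerivAt_const v y)).clm_apply (hasFDerivAt_const w y)
  have d₂ := (d.clm_apply (hasFDerivAt_const w y)).clm_apply (hasFDerivAt_const v y)
  have e : (fun z => g z v w) =ᶠ[nhds y] fun z => g z w v := by
    filter_upwards [hg.isOpen.mem_nhds hy] with z hz using hg.symm z hz v w
  have := congrArg (fun l => l u) (d₁.unique (d₂.congr_of_eventuallyEq e))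
  simpa using this

theorem IsMetricOn.christoffel_symm (hg : IsMetricOn g U) (hy : y ∈ U) (u v : Model n) :
    christoffel g y u v = christoffel g y v u := by
  refine (hg.nondeg y hy).ext fun w => ?_
  rw [hg.koszul hy, hg.koszul hy, hg.fderiv_symm hy w u v]
  ring

/-- This is ∇g = 0. With the symmetry of Γ it removes the derivatives of g from the conformal
curvature computation. -/
theorem IsMetricOn.compat (hg : IsMetricOn g U) (hy : y ∈ U) (u v w : Model n) :
    fderiv ℝ g y u v w = g y (christoffel g y u v) w + g y v (christoffel g y u w) := by
  rw [hg.symm y hy v, hg.koszul hy, hg.koszul hy, hg.fderiv_symm hy u w v,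
    hg.fderiv_symm hy w u v, hg.fderiv_symm hy v u w]
  ring

theorem IsMetricOn.contDiffOn_christoffelMap (hg : IsMetricOn g U) :
    ContDiffOn ℝ ∞ (christoffelMap g) U := by
  rw [contDiffOn_clm_apply]
  intro u
  rw [contDiffOn_clm_apply]
  intro v z hz
  have h := hg.contDiffAt hz
  have h' : ContDiffAt ℝ ∞ (fderiv ℝ g) z := h.fderiv_right (by simp)
  have inv : ContDiffAt ℝ ∞ (fun z => ContinuousLinearMap.inverse (g z)) z :=
    ContDiffAt.comp z ((hg.nondeg z hz).isInvertible.contDiffAt_map_inverse) h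
  have c₁ : ContDiffAt ℝ ∞ (fun z => fderiv ℝ g z u v) z :=
    (h'.clm_apply contDiffAt_const).clm_apply contDiffAt_const
  have c₂ : ContDiffAt ℝ ∞ (fun z => fderiv ℝ g z v u) z :=
    (h'.clm_apply contDiffAt_const).clm_apply contDiffAt_const
  have c₃ : ContDiffAt ℝ ∞ (fun z => ((fderiv ℝ g z).flip u).flip v) z := by
    have f₁ := (ContinuousLinearMap.flipₗᵢ ℝ (Model n) (Model n)
      (Model n →L[ℝ] ℝ)).toContinuousLinearEquiv.contDiff.contDiffAt.comp z h'
    have f₂ : ContDiffAt ℝ ∞ (fun z => (fderiv ℝ g z).flip u) z :=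
      f₁.clm_apply contDiffAt_const
    have f₃ := (ContinuousLinearMap.flipₗᵢ ℝ (Model n) (Model n)
      ℝ).toContinuousLinearEquiv.contDiff.contDiffAt.comp z f₂
    exact f₃.clm_apply contDiffAt_const
  exact (inv.clm_apply (((c₁.add c₂).sub c₃).const_smul (1 / 2 : ℝ))).contDiffWithinAt

theorem IsMetricOn.differentiableAt_christoffelMap (hg : IsMetricOn g U) (hy : y ∈ U) :
    DifferentiableAt ℝ (christoffelMap g) y :=
  (hg.contDiffOn_christoffelMap.contDiffAt (hg.isOpen.mem_nhds hy)).differentiableAt (by simp)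

/-- For vectors `v`, `w`, the operator `u ↦ R(u, v) w`, where `R` is the curvature of the
connection with Christoffel symbols `Γ`. -/
def curvatureOp (Γ : Model n → Model n →L[ℝ] Model n →L[ℝ] Model n) (y v w : Model n) :
    Model n →L[ℝ] Model n :=
  (((fderiv ℝ Γ y).flip v).flip w + (Γ y).flip (Γ y v w))
    - ((fderiv ℝ Γ y v).flip w + Γ y v ∘L (Γ y).flip w)

theorem curvatureOp_apply (Γ : Model n → Model n →L[ℝ] Model n →L[ℝ] Model n)
    (y u v w : Model n) : curvatureOp Γ y v w u
      = (fderiv ℝ Γ y u v w + Γ y u (Γ y v w)) - (fderiv ℝ Γ y v u w + Γ y v (Γ y u w)) := rfl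

theorem IsMetricOn.curvature_eq (hg : IsMetricOn g U) (hy : y ∈ U) (u v w : Model n) :
    curvature g y u v w = curvatureOp (christoffelMap g) y v w u := by
  have d := (hg.differentiableAt_christoffelMap hy).hasFDerivAt
  have e : ∀ v w, fderiv ℝ (fun z => christoffel g z v w) y
      = ((fderiv ℝ (christoffelMap g) y).flip v).flip w := by
    intro v w
    have := (d.clm_apply (hasFDerivAt_const v y)).clm_apply (hasFDerivAt_const w y)
    refine this.fderiv.trans ?_
    ext u
    simp
  rw [curvatureOp_apply, curvature, e, e]
  rfl

theorem IsMetricOn.ricci_eq (hg : IsMetricOn g U) (hy : y ∈ U) (v w : Model n) :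
    ricci g y v w = endTrace (curvatureOp (christoffelMap g) y v w) := by
  rw [endTrace_eq_sum, ricci]
  simp only [hg.curvature_eq hy]

end Connection

/-! ### Naturality under local isometries -/

section Natural

theorem two_le_infty : (2 : WithTop ℕ∞) ≤ ∞ :=
  WithTop.coe_le_coe.2 (le_top : (2 : ℕ∞) ≤ ⊤)

variable {n : ℕ}

/-- The Hessian as a bilinear map. -/
def hessianMap {F : Type*} [NormedAddCommGroup F] [NormedSpace ℝ F]
    (g : Model n → Model n →L[ℝ] Model n →L[ℝ] ℝ) (f : Model n → F) (y : Model n) :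
    Model n →L[ℝ] Model n →L[ℝ] F :=
  fderiv ℝ (fderiv ℝ f) y
    - (ContinuousLinearMap.compL ℝ (Model n) (Model n) F (fderiv ℝ f y)) ∘L christoffelMap g y

theorem hessianMap_apply {F : Type*} [NormedAddCommGroup F] [NormedSpace ℝ F]
    (g : Model n → Model n →L[ℝ] Model n →L[ℝ] ℝ) (f : Model n → F) (y u v : Model n) :
    hessianMap g f y u v
      = fderiv ℝ (fderiv ℝ f) y u v - fderiv ℝ f y (christoffel g y u v) := rfl

theorem localLaplacian_eq (g : Model n → Model n →L[ℝ] Model n →L[ℝ] ℝ) (f : Model n → ℂ)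
    (y : Model n) : localLaplacian g f y = metricTrace (g y) (fun u v => hessianMap g f y u v) :=
  rfl

/-- The Ricci tensor of a connection as a bilinear map. -/
def ricciMap (Γ : Model n → Model n →L[ℝ] Model n →L[ℝ] Model n) (y : Model n) :
    Model n →L[ℝ] Model n →L[ℝ] ℝ :=
  (LinearMap.mk₂ ℝ (fun v w => endTrace (curvatureOp Γ y v w))
    (fun v v' w => by
      rw [← map_add]
      congr 1
      ext1 u
      simp only [curvatureOp_apply, map_add, _root_.add_apply]
      abel)
    (fun c v w => by
      rw [← map_smul]
      congr 1
      ext1 u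
      simp only [curvatureOp_apply, map_smul, _root_.smul_apply]
      module)
    (fun v w w' => by
      rw [← map_add]
      congr 1
      ext1 u
      simp only [curvatureOp_apply, map_add, _root_.add_apply]
      abel)
    (fun c v w => by
      rw [← map_smul]
      congr 1
      ext1 u
      simp only [curvatureOp_apply, map_smul, _root_.smul_apply]
      module)).toContinuousBilinearMap

theorem ricciMap_apply (Γ : Model n → Model n →L[ℝ] Model n →L[ℝ] Model n) (y v w : Model n) :
    ricciMap Γ y v w = endTrace (curvatureOp Γ y v w) := rfl

variable {g h : Model n → Model n →L[ℝ] Model n →L[ℝ] ℝ} {U V : Set (Model n)} {y : Model n}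

theorem IsMetricOn.localScalarCurvature_eq (hg : IsMetricOn g U) (hy : y ∈ U) :
    localScalarCurvature g y
      = metricTrace (g y) (fun v w => ricciMap (christoffelMap g) y v w) := by
  simp only [ricciMap_apply, ← hg.ricci_eq hy]
  rfl

/-- `F` is a local diffeomorphism from `U` into `V`. -/
structure IsLocalDiffeoOn (F : Model n → Model n) (U V : Set (Model n)) : Prop where
  isOpen : IsOpen U
  mapsTo : Set.MapsTo F U V
  contDiffOn : ContDiffOn ℝ ∞ F U
  isInvertible : ∀ z ∈ U, (fderiv ℝ F z).IsInvertible

/-- The metric `h` is the pull-back of `g` by `F` on `U`. -/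
def IsPullbackOn (h g : Model n → Model n →L[ℝ] Model n →L[ℝ] ℝ) (F : Model n → Model n)
    (U : Set (Model n)) : Prop :=
  ∀ z ∈ U, ∀ u v, h z u v = g (F z) (fderiv ℝ F z u) (fderiv ℝ F z v)

variable {F : Model n → Model n}

theorem IsLocalDiffeoOn.contDiffAt (hF : IsLocalDiffeoOn F U V) (hy : y ∈ U) :
    ContDiffAt ℝ ∞ F y :=
  hF.contDiffOn.contDiffAt (hF.isOpen.mem_nhds hy)

theorem IsLocalDiffeoOn.hasFDerivAt (hF : IsLocalDiffeoOn F U V) (hy : y ∈ U) :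
    HasFDerivAt F (fderiv ℝ F y) y :=
  ((hF.contDiffAt hy).differentiableAt (by simp)).hasFDerivAt

theorem IsLocalDiffeoOn.contDiffAt_fderiv (hF : IsLocalDiffeoOn F U V) (hy : y ∈ U) :
    ContDiffAt ℝ ∞ (fderiv ℝ F) y :=
  (hF.contDiffAt hy).fderiv_right (by simp)

theorem IsLocalDiffeoOn.hasFDerivAt_fderiv (hF : IsLocalDiffeoOn F U V) (hy : y ∈ U) :
    HasFDerivAt (fderiv ℝ F) (fderiv ℝ (fderiv ℝ F) y) y :=
  ((hF.contDiffAt_fderiv hy).differentiableAt (by simp)).hasFDerivAt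

theorem IsLocalDiffeoOn.hasFDerivAt_fderiv_fderiv (hF : IsLocalDiffeoOn F U V) (hy : y ∈ U) :
    HasFDerivAt (fderiv ℝ (fderiv ℝ F)) (fderiv ℝ (fderiv ℝ (fderiv ℝ F)) y) y :=
  (((hF.contDiffAt_fderiv hy).fderiv_right (m := ∞) (by simp)).differentiableAt
    (by simp)).hasFDerivAt

theorem IsLocalDiffeoOn.fderiv_fderiv_symm (hF : IsLocalDiffeoOn F U V) (hy : y ∈ U)
    (u v : Model n) : fderiv ℝ (fderiv ℝ F) y u v = fderiv ℝ (fderiv ℝ F) y v u :=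
  (hF.contDiffAt hy).isSymmSndFDerivAt (by simpa using two_le_infty) u v

theorem IsLocalDiffeoOn.fderiv_fderiv_fderiv_symm (hF : IsLocalDiffeoOn F U V) (hy : y ∈ U)
    (u v : Model n) : fderiv ℝ (fderiv ℝ (fderiv ℝ F)) y u v
      = fderiv ℝ (fderiv ℝ (fderiv ℝ F)) y v u :=
  (hF.contDiffAt_fderiv hy).isSymmSndFDerivAt (by simpa using two_le_infty) u v

theorem IsPullbackOn.fderiv_apply (hF : IsLocalDiffeoOn F U V) (hg : IsMetricOn g V)
    (hh : IsMetricOn h U) (hp : IsPullbackOn h g F U) (hy : y ∈ U) (a u v : Model n) :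
    fderiv ℝ h y a u v
      = fderiv ℝ g (F y) (fderiv ℝ F y a) (fderiv ℝ F y u) (fderiv ℝ F y v)
        + g (F y) (fderiv ℝ (fderiv ℝ F) y a u) (fderiv ℝ F y v)
        + g (F y) (fderiv ℝ F y u) (fderiv ℝ (fderiv ℝ F) y a v) := by
  have d := (hh.differentiableAt hy).hasFDerivAt
  have d₁ := (d.clm_apply (hasFDerivAt_const u y)).clm_apply (hasFDerivAt_const v y)
  have dg := (hg.differentiableAt (hF.mapsTo hy)).hasFDerivAt.comp y (hF.hasFDerivAt hy)
  have dA := hF.hasFDerivAt_fderiv hy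
  have d₂ := (dg.clm_apply (dA.clm_apply (hasFDerivAt_const u y))).clm_apply
    (dA.clm_apply (hasFDerivAt_const v y))
  have e : (fun z => h z u v) =ᶠ[nhds y]
      fun z => g (F z) (fderiv ℝ F z u) (fderiv ℝ F z v) := by
    filter_upwards [hF.isOpen.mem_nhds hy] with z hz using hp z hz u v
  have := congrArg (fun l => l a) (d₁.unique (d₂.congr_of_eventuallyEq e))
  simp at this
  rw [this]
  ring

/-- The inhomogeneous transformation law of a connection. Since DF is onto, it suffices to pair with
vectors DF w. Both sides are then given by the Koszul formula, and the extra terms combine by the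
symmetry of D²F. -/
theorem IsPullbackOn.christoffel (hF : IsLocalDiffeoOn F U V) (hg : IsMetricOn g V)
    (hh : IsMetricOn h U) (hp : IsPullbackOn h g F U) (hy : y ∈ U) (u v : Model n) :
    fderiv ℝ F y (christoffel h y u v)
      = christoffel g (F y) (fderiv ℝ F y u) (fderiv ℝ F y v)
        + fderiv ℝ (fderiv ℝ F) y u v := by
  refine (hg.nondeg _ (hF.mapsTo hy)).ext fun w' => ?_
  obtain ⟨A, hA⟩ := hF.isInvertible y hy
  obtain ⟨w, rfl⟩ := A.surjective w'
  have e : A w = fderiv ℝ F y w := congrArg (fun T => T w) hA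
  rw [e, ← hp y hy, hh.koszul hy, map_add, _root_.add_apply, hg.koszul (hF.mapsTo hy)]
  simp only [hp.fderiv_apply hF hg hh hy]
  have s := hg.symm _ (hF.mapsTo hy)
  rw [hF.fderiv_fderiv_symm hy v u, hF.fderiv_fderiv_symm hy w u, hF.fderiv_fderiv_symm hy w v,
    s (fderiv ℝ F y v) (fderiv ℝ (fderiv ℝ F) y u w)]
  ring

/-- Only the transformation law of the two connections matters, not the metrics. Differentiating it
once and antisymmetrizing removes D³F by symmetry; the remaining D²F terms cancel after the law is
applied again to the quadratic terms. -/
theorem curvatureOp_natural {Γ Γ' : Model n → Model n →L[ℝ] Model n →L[ℝ] Model n}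
    (hF : IsLocalDiffeoOn F U V) (hy : y ∈ U)
    (hΓ : DifferentiableAt ℝ Γ y) (hΓ' : DifferentiableAt ℝ Γ' (F y))
    (hs : ∀ z ∈ U, ∀ u v, fderiv ℝ F z (Γ z u v)
      = Γ' (F z) (fderiv ℝ F z u) (fderiv ℝ F z v) + fderiv ℝ (fderiv ℝ F) z u v)
    (u v w : Model n) :
    fderiv ℝ F y (curvatureOp Γ y v w u)
      = curvatureOp Γ' (F y) (fderiv ℝ F y v) (fderiv ℝ F y w) (fderiv ℝ F y u) := by
  have dA := hF.hasFDerivAt_fderiv hy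
  have dB := hF.hasFDerivAt_fderiv_fderiv hy
  have dΓ' := hΓ'.hasFDerivAt.comp y (hF.hasFDerivAt hy)
  -- The derivative of the transformation law in the direction a, solved for the term containing DΓ.
  have key : ∀ a u v, fderiv ℝ F y (fderiv ℝ Γ y a u v)
      = fderiv ℝ Γ' (F y) (fderiv ℝ F y a) (fderiv ℝ F y u) (fderiv ℝ F y v)
        + Γ' (F y) (fderiv ℝ (fderiv ℝ F) y a u) (fderiv ℝ F y v)
        + Γ' (F y) (fderiv ℝ F y u) (fderiv ℝ (fderiv ℝ F) y a v)
        + fderiv ℝ (fderiv ℝ (fderiv ℝ F)) y a u v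
        - fderiv ℝ (fderiv ℝ F) y a (Γ y u v) := by
    intro a u v
    have d₁ := dA.clm_apply ((hΓ.hasFDerivAt.clm_apply (hasFDerivAt_const u y)).clm_apply
      (hasFDerivAt_const v y))
    have d₂ := ((dΓ'.clm_apply (dA.clm_apply (hasFDerivAt_const u y))).clm_apply
      (dA.clm_apply (hasFDerivAt_const v y))).add
      ((dB.clm_apply (hasFDerivAt_const u y)).clm_apply (hasFDerivAt_const v y))
    have e : (fun z => fderiv ℝ F z (Γ z u v)) =ᶠ[nhds y] _ :=
      Filter.eventually_of_mem (hF.isOpen.mem_nhds hy) fun z hz => hs z hz u v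
    have := congrArg (fun l => l a) (d₁.unique (d₂.congr_of_eventuallyEq e))
    simp at this
    rw [eq_sub_iff_add_eq, this]
    abel
  simp only [curvatureOp_apply, map_sub, map_add, key, hs y hy]
  rw [hF.fderiv_fderiv_symm hy v u, hF.fderiv_fderiv_fderiv_symm hy v u]
  abel

theorem IsPullbackOn.eq_bilinearComp (hp : IsPullbackOn h g F U) (hy : y ∈ U)
    {A : Model n ≃L[ℝ] Model n} (hA : (A : Model n →L[ℝ] Model n) = fderiv ℝ F y) :
    h y = (g (F y)).bilinearComp (A : Model n →L[ℝ] Model n) (A : Model n →L[ℝ] Model n) := by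
  ext u v
  rw [hp y hy, hA]
  rfl

theorem IsPullbackOn.localScalarCurvature_eq (hF : IsLocalDiffeoOn F U V) (hg : IsMetricOn g V)
    (hh : IsMetricOn h U) (hp : IsPullbackOn h g F U) (hy : y ∈ U) :
    localScalarCurvature h y = localScalarCurvature g (F y) := by
  obtain ⟨A, hA⟩ := hF.isInvertible y hy
  have e : ∀ u, A u = fderiv ℝ F y u := fun u => congrArg (fun T => T u) hA
  rw [hh.localScalarCurvature_eq hy, hg.localScalarCurvature_eq (hF.mapsTo hy),
    ← (hg.nondeg _ (hF.mapsTo hy)).metricTrace_bilinearComp A, ← hp.eq_bilinearComp hy hA]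
  congr 1
  funext v w
  rw [ricciMap_apply, ricciMap_apply]
  refine endTrace_conj A _ _ fun u => ?_
  simp only [e]
  exact curvatureOp_natural hF hy (hh.differentiableAt_christoffelMap hy)
    (hg.differentiableAt_christoffelMap (hF.mapsTo hy))
    (fun z hz u v => hp.christoffel hF hg hh hz u v) u v w

theorem IsPullbackOn.localLaplacian_eq (hF : IsLocalDiffeoOn F U V) (hg : IsMetricOn g V)
    (hh : IsMetricOn h U) (hp : IsPullbackOn h g F U) (hy : y ∈ U) {f : Model n → ℂ}
    (hf : ContDiffOn ℝ ∞ f V) :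
    localLaplacian h (f ∘ F) y = localLaplacian g f (F y) := by
  obtain ⟨A, hA⟩ := hF.isInvertible y hy
  have e : ∀ u, A u = fderiv ℝ F y u := fun u => congrArg (fun T => T u) hA
  have cf : ∀ z ∈ U, ContDiffAt ℝ ∞ f (F z) := fun z hz =>
    hf.contDiffAt (hg.isOpen.mem_nhds (hF.mapsTo hz))
  have df : fderiv ℝ (f ∘ F) =ᶠ[nhds y] fun z => fderiv ℝ f (F z) ∘L fderiv ℝ F z := by
    filter_upwards [hF.isOpen.mem_nhds hy] with z hz
    exact (((cf z hz).differentiableAt (by simp)).hasFDerivAt.comp z (hF.hasFDerivAt hz)).fderiv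
  have ddf : HasFDerivAt (fderiv ℝ f) (fderiv ℝ (fderiv ℝ f) (F y)) (F y) :=
    (((cf y hy).fderiv_right (m := ∞) (by simp)).differentiableAt (by simp)).hasFDerivAt
  have dd := ((ddf.comp y (hF.hasFDerivAt hy)).clm_comp
    (hF.hasFDerivAt_fderiv hy)).congr_of_eventuallyEq df
  rw [ConformalGeometry.localLaplacian_eq, ConformalGeometry.localLaplacian_eq,
    ← (hg.nondeg _ (hF.mapsTo hy)).metricTrace_bilinearComp A, ← hp.eq_bilinearComp hy hA]
  congr 1
  funext u v
  rw [hessianMap_apply, hessianMap_apply, dd.fderiv, df.self_of_nhds, e, e]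
  simp [hp.christoffel hF hg hh hy]
  ring

end Natural

/-! ### Conformal change of metric -/

section Conformal

variable {n : ℕ}

/-- The two brackets are the covariant derivatives (∇ᵤC)(v, w) and (∇ᵥC)(u, w). The added terms
C(Γ(u, v), w) and C(Γ(v, u), w) cancel because Γ is torsion-free. -/
theorem curvatureOp_add_apply {Γ C : Model n → Model n →L[ℝ] Model n →L[ℝ] Model n}
    {y : Model n} (hΓ : DifferentiableAt ℝ Γ y) (hC : DifferentiableAt ℝ C y)
    (hs : ∀ u v, Γ y u v = Γ y v u) (u v w : Model n) :
    curvatureOp (Γ + C) y v w u = curvatureOp Γ y v w u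
      + (fderiv ℝ C y u v w + Γ y u (C y v w) - C y (Γ y u v) w - C y v (Γ y u w))
      - (fderiv ℝ C y v u w + Γ y v (C y u w) - C y (Γ y v u) w - C y u (Γ y v w))
      + C y u (C y v w) - C y v (C y u w) := by
  simp only [curvatureOp_apply, fderiv_add hΓ hC, _root_.add_apply, Pi.add_apply, map_add, hs v u]
  abel

/-- The difference `(u, v) ↦ a(u) v + a(v) u - b(u, v) X` of the Levi-Civita connections of two
conformal metrics. -/
def conformalDifference (a : Model n →L[ℝ] ℝ) (b : Model n →L[ℝ] Model n →L[ℝ] ℝ)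
    (X : Model n) : Model n →L[ℝ] Model n →L[ℝ] Model n :=
  (LinearMap.mk₂ ℝ (fun u v => a u • v + a v • u - b u v • X)
    (fun u u' v => by simp only [map_add, _root_.add_apply]; module)
    (fun c u v => by simp only [map_smul, _root_.smul_apply, smul_eq_mul]; module)
    (fun u v v' => by simp only [map_add]; module)
    (fun c u v => by simp only [map_smul, smul_eq_mul]; module)).toContinuousBilinearMap

theorem conformalDifference_apply (a : Model n →L[ℝ] ℝ) (b : Model n →L[ℝ] Model n →L[ℝ] ℝ)
    (X u v : Model n) :
    conformalDifference a b X u v = a u • v + a v • u - b u v • X := rfl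

variable {g h : Model n → Model n →L[ℝ] Model n →L[ℝ] ℝ} {U : Set (Model n)} {y : Model n}
  {φ : Model n → ℝ}

/-- The gradient of a function. -/
def grad (g : Model n → Model n →L[ℝ] Model n →L[ℝ] ℝ) (φ : Model n → ℝ) (y : Model n) :
    Model n :=
  ContinuousLinearMap.inverse (g y) (fderiv ℝ φ y)

/-- The covariant derivative of the gradient. -/
def gradDeriv (g : Model n → Model n →L[ℝ] Model n →L[ℝ] ℝ) (φ : Model n → ℝ) (y : Model n) :
    Model n →L[ℝ] Model n :=
  fderiv ℝ (grad g φ) y + (christoffelMap g y).flip (grad g φ y)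

theorem IsMetricOn.apply_grad (hg : IsMetricOn g U) (hy : y ∈ U) (v : Model n) :
    g y (grad g φ y) v = fderiv ℝ φ y v := by
  rw [grad, (hg.nondeg y hy).apply_inverse]

theorem IsMetricOn.contDiffAt_grad (hg : IsMetricOn g U) (hφ : ContDiffOn ℝ ∞ φ U) (hy : y ∈ U) :
    ContDiffAt ℝ ∞ (grad g φ) y := by
  have inv : ContDiffAt ℝ ∞ (fun z => ContinuousLinearMap.inverse (g z)) y :=
    ContDiffAt.comp y ((hg.nondeg y hy).isInvertible.contDiffAt_map_inverse) (hg.contDiffAt hy)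
  exact inv.clm_apply ((hφ.contDiffAt (hg.isOpen.mem_nhds hy)).fderiv_right (by simp))

theorem IsMetricOn.hasFDerivAt_grad (hg : IsMetricOn g U) (hφ : ContDiffOn ℝ ∞ φ U)
    (hy : y ∈ U) : HasFDerivAt (grad g φ) (fderiv ℝ (grad g φ) y) y :=
  ((hg.contDiffAt_grad hφ hy).differentiableAt (by simp)).hasFDerivAt

theorem hasFDerivAt_fderiv_of_contDiffOn {F : Type*} [NormedAddCommGroup F] [NormedSpace ℝ F]
    {f : Model n → F} (hU : IsOpen U) (hf : ContDiffOn ℝ ∞ f U) (hy : y ∈ U) :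
    HasFDerivAt (fderiv ℝ f) (fderiv ℝ (fderiv ℝ f) y) y :=
  (((hf.contDiffAt (hU.mem_nhds hy)).fderiv_right (m := ∞) (by simp)).differentiableAt
    (by simp)).hasFDerivAt

theorem IsMetricOn.hessianMap_symm {F : Type*} [NormedAddCommGroup F] [NormedSpace ℝ F]
    {f : Model n → F} (hg : IsMetricOn g U) (hf : ContDiffOn ℝ ∞ f U) (hy : y ∈ U)
    (u v : Model n) : hessianMap g f y u v = hessianMap g f y v u := by
  rw [hessianMap_apply, hessianMap_apply, hg.christoffel_symm hy u v,
    (hf.contDiffAt (hg.isOpen.mem_nhds hy)).isSymmSndFDerivAt (by simpa using two_le_infty) u v]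

/-- Differentiate g(∇φ, w) = dφ(w) and use compatibility of the connection with g: the covariant
derivative of the gradient is the Hessian with an index raised. -/
theorem IsMetricOn.apply_gradDeriv (hg : IsMetricOn g U) (hφ : ContDiffOn ℝ ∞ φ U) (hy : y ∈ U)
    (u w : Model n) : g y (gradDeriv g φ y u) w = hessianMap g φ y u w := by
  have d₁ := ((hg.differentiableAt hy).hasFDerivAt.clm_apply (hg.hasFDerivAt_grad hφ hy)).clm_apply
    (hasFDerivAt_const w y)
  have d₂ := (hasFDerivAt_fderiv_of_contDiffOn hg.isOpen hφ hy).clm_apply (hasFDerivAt_const w y)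
  have e : (fun z => g z (grad g φ z) w) =ᶠ[nhds y] fun z => fderiv ℝ φ z w :=
    Filter.eventually_of_mem (hg.isOpen.mem_nhds hy) fun z hz => hg.apply_grad hz w
  have := congrArg (fun l => l u) (d₁.unique (d₂.congr_of_eventuallyEq e))
  simp [hg.compat hy, hg.apply_grad hy] at this
  rw [hessianMap_apply, ← this, gradDeriv]
  simp
  ring

theorem IsMetricOn.metricTrace_hessianMap (hg : IsMetricOn g U) (hφ : ContDiffOn ℝ ∞ φ U)
    (hy : y ∈ U) :
    metricTrace (g y) (fun u v => hessianMap g φ y u v) = endTrace (gradDeriv g φ y) :=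
  (hg.nondeg y hy).metricTrace_operator (hg.symm y hy) (hg.hessianMap_symm hφ hy) _
    (hg.apply_gradDeriv hφ hy)

/-- The metrics are related by `h = e^{2 φ} g` on `U`. -/
def IsConformalOn (h g : Model n → Model n →L[ℝ] Model n →L[ℝ] ℝ) (φ : Model n → ℝ)
    (U : Set (Model n)) : Prop :=
  ∀ z ∈ U, h z = Real.exp (2 * φ z) • g z

theorem IsConformalOn.isMetricOn (hg : IsMetricOn g U) (hφ : ContDiffOn ℝ ∞ φ U)
    (hc : IsConformalOn h g φ U) : IsMetricOn h U where
  isOpen := hg.isOpen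
  symm z hz u v := by simp [hc z hz, hg.symm z hz u v]
  nondeg z hz := by
    rw [hc z hz]
    exact (hg.nondeg z hz).smul (Real.exp_pos _).ne'
  contDiffOn := (((contDiffOn_const.mul hφ).exp).smul hg.contDiffOn).congr hc

theorem IsConformalOn.fderiv_apply (hg : IsMetricOn g U) (hφ : ContDiffOn ℝ ∞ φ U)
    (hc : IsConformalOn h g φ U) (hy : y ∈ U) (u v w : Model n) :
    fderiv ℝ h y u v w
      = Real.exp (2 * φ y) * (fderiv ℝ g y u v w + 2 * fderiv ℝ φ y u * g y v w) := by
  have dφ := ((hφ.contDiffAt (hg.isOpen.mem_nhds hy)).differentiableAt (by simp)).hasFDerivAt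
  have d := ((dφ.const_mul 2).exp.smul (hg.differentiableAt hy).hasFDerivAt).congr_of_eventuallyEq
    (Filter.eventually_of_mem (hg.isOpen.mem_nhds hy) hc)
  rw [d.fderiv]
  simp
  ring

theorem IsConformalOn.christoffelMap (hg : IsMetricOn g U) (hφ : ContDiffOn ℝ ∞ φ U)
    (hc : IsConformalOn h g φ U) (hy : y ∈ U) :
    christoffelMap h y
      = christoffelMap g y + conformalDifference (fderiv ℝ φ y) (g y) (grad g φ y) := by
  have hh := hc.isMetricOn hg hφ
  ext1 u
  ext1 v
  refine (hh.nondeg y hy).ext fun w => ?_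
  rw [christoffelMap_apply, hh.koszul hy]
  simp only [hc.fderiv_apply hg hφ hy, hc y hy, _root_.add_apply, _root_.smul_apply, map_add,
    christoffelMap_apply, hg.koszul hy, conformalDifference_apply, map_sub, map_smul,
    _root_.sub_apply, hg.apply_grad hy, smul_eq_mul]
  ring

/-- The squared length of the gradient. -/
def gradSq (g : Model n → Model n →L[ℝ] Model n →L[ℝ] ℝ) (φ : Model n → ℝ) (y : Model n) : ℝ :=
  fderiv ℝ φ y (grad g φ y)

/-- With C the difference of the connections, ∇C contains only the Hessian of φ and the derivative
of its gradient, because ∇g = 0. The terms quadratic in dφ come from the commutator of C with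
itself. -/
theorem IsConformalOn.curvatureOp_apply (hg : IsMetricOn g U) (hφ : ContDiffOn ℝ ∞ φ U)
    (hc : IsConformalOn h g φ U) (hy : y ∈ U) (u v w : Model n) :
    curvatureOp (ConformalGeometry.christoffelMap h) y v w u
      = curvatureOp (ConformalGeometry.christoffelMap g) y v w u
        + (hessianMap g φ y u w • v - g y v w • gradDeriv g φ y u)
        - (hessianMap g φ y v w • u - g y u w • gradDeriv g φ y v)
        + (fderiv ℝ φ y v * fderiv ℝ φ y w) • u - (fderiv ℝ φ y u * fderiv ℝ φ y w) • v
        - gradSq g φ y • (g y v w • u - g y u w • v)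
        + (g y v w * fderiv ℝ φ y u - g y u w * fderiv ℝ φ y v) • grad g φ y := by
  set C : Model n → Model n →L[ℝ] Model n →L[ℝ] Model n :=
    fun z => conformalDifference (fderiv ℝ φ z) (g z) (grad g φ z) with hC
  have dg := (hg.differentiableAt hy).hasFDerivAt
  have da := hasFDerivAt_fderiv_of_contDiffOn hg.isOpen hφ hy
  have dX := hg.hasFDerivAt_grad hφ hy
  have cC : ContDiffOn ℝ ∞ C U := by
    rw [contDiffOn_clm_apply]
    intro u
    rw [contDiffOn_clm_apply]
    intro v z hz
    have a : ContDiffAt ℝ ∞ (fderiv ℝ φ) z :=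
      (hφ.contDiffAt (hg.isOpen.mem_nhds hz)).fderiv_right (by simp)
    have b := hg.contDiffAt hz
    have X := hg.contDiffAt_grad hφ hz
    exact ((((a.clm_apply contDiffAt_const).smul contDiffAt_const).add
      ((a.clm_apply contDiffAt_const).smul contDiffAt_const)).sub
      (((b.clm_apply contDiffAt_const).clm_apply contDiffAt_const).smul X)).contDiffWithinAt
  have dC : DifferentiableAt ℝ C y :=
    (cC.contDiffAt (hg.isOpen.mem_nhds hy)).differentiableAt (by simp)
  -- The product rule for C(v, w) = dφ(v) w + dφ(w) v - g(v, w) ∇φ with v and w constant.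
  have C' : ∀ u v w, fderiv ℝ C y u v w
      = fderiv ℝ (fderiv ℝ φ) y u v • w + fderiv ℝ (fderiv ℝ φ) y u w • v
        - fderiv ℝ g y u v w • grad g φ y - g y v w • fderiv ℝ (grad g φ) y u := by
    intro u v w
    have d₁ := (dC.hasFDerivAt.clm_apply (hasFDerivAt_const v y)).clm_apply (hasFDerivAt_const w y)
    have d₂ := (((da.clm_apply (hasFDerivAt_const v y)).smul (hasFDerivAt_const w y)).add
      ((da.clm_apply (hasFDerivAt_const w y)).smul (hasFDerivAt_const v y))).sub
      (((dg.clm_apply (hasFDerivAt_const v y)).clm_apply (hasFDerivAt_const w y)).smul dX)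
    have := congrArg (fun l => l u) (d₁.unique d₂)
    simp at this
    rw [this]
    module
  have e : ConformalGeometry.christoffelMap h =ᶠ[nhds y] ConformalGeometry.christoffelMap g + C :=
    Filter.eventually_of_mem (hg.isOpen.mem_nhds hy) fun z hz => hc.christoffelMap hg hφ hz
  have e' : curvatureOp (ConformalGeometry.christoffelMap h) y v w u
      = curvatureOp (ConformalGeometry.christoffelMap g + C) y v w u := by
    rw [ConformalGeometry.curvatureOp_apply, ConformalGeometry.curvatureOp_apply, e.fderiv_eq,
      e.self_of_nhds]
  have Cy : ∀ u v, C y u v = fderiv ℝ φ y u • v + fderiv ℝ φ y v • u - g y u v • grad g φ y :=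
    fun u v => rfl
  have S : ∀ u, gradDeriv g φ y u
      = fderiv ℝ (grad g φ) y u + christoffel g y u (grad g φ y) := fun u => rfl
  rw [e', curvatureOp_add_apply (hg.differentiableAt_christoffelMap hy) dC
    (hg.christoffel_symm hy)]
  simp only [C', Cy, S, hessianMap_apply, gradSq, christoffelMap_apply, map_add, map_sub, map_smul,
    smul_eq_mul, hg.compat hy, hg.apply_grad hy, hg.symm y hy _ (grad g φ y), hg.symm y hy v u,
    hg.christoffel_symm hy v u, (hφ.contDiffAt (hg.isOpen.mem_nhds hy)).isSymmSndFDerivAt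
      (by simpa using two_le_infty) v u]
  module

theorem IsConformalOn.ricciMap_apply (hg : IsMetricOn g U) (hφ : ContDiffOn ℝ ∞ φ U)
    (hc : IsConformalOn h g φ U) (hy : y ∈ U) (v w : Model n) :
    ricciMap (ConformalGeometry.christoffelMap h) y v w
      = ricciMap (ConformalGeometry.christoffelMap g) y v w
        + -((n : ℝ) - 2) * hessianMap g φ y v w
        + ((n : ℝ) - 2) * (fderiv ℝ φ y v * fderiv ℝ φ y w)
        + -(endTrace (gradDeriv g φ y) + ((n : ℝ) - 2) * gradSq g φ y) * g y v w := by
  -- As an operator in u, the correction is a combination of the identity, rank-one operators and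
  -- `gradDeriv`, so its trace can be read off term by term.
  have e : curvatureOp (ConformalGeometry.christoffelMap h) y v w
      = curvatureOp (ConformalGeometry.christoffelMap g) y v w
        + (((hessianMap g φ y).flip w).smulRight v - g y v w • gradDeriv g φ y)
        - (hessianMap g φ y v w • ContinuousLinearMap.id ℝ (Model n)
            - ((g y).flip w).smulRight (gradDeriv g φ y v))
        + (fderiv ℝ φ y v * fderiv ℝ φ y w) • ContinuousLinearMap.id ℝ (Model n)
        - fderiv ℝ φ y w • (fderiv ℝ φ y).smulRight v
        - gradSq g φ y • (g y v w • ContinuousLinearMap.id ℝ (Model n)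
            - ((g y).flip w).smulRight v)
        + (g y v w • (fderiv ℝ φ y).smulRight (grad g φ y)
            - fderiv ℝ φ y v • ((g y).flip w).smulRight (grad g φ y)) := by
    ext1 u
    rw [hc.curvatureOp_apply hg hφ hy]
    simp only [_root_.add_apply, _root_.sub_apply, _root_.smul_apply,
      ContinuousLinearMap.smulRight_apply, ContinuousLinearMap.flip_apply,
      ContinuousLinearMap.id_apply]
    module
  rw [ConformalGeometry.ricciMap_apply, ConformalGeometry.ricciMap_apply, e]
  simp only [map_add, map_sub, map_smul, endTrace_smulRight, endTrace_id,
    ContinuousLinearMap.flip_apply, hg.apply_gradDeriv hφ hy, hg.apply_grad hy, smul_eq_mul]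
  rw [show fderiv ℝ φ y (grad g φ y) = gradSq g φ y from rfl]
  ring

theorem IsConformalOn.localScalarCurvature_eq (hg : IsMetricOn g U) (hφ : ContDiffOn ℝ ∞ φ U)
    (hc : IsConformalOn h g φ U) (hy : y ∈ U) :
    localScalarCurvature h y = (Real.exp (2 * φ y))⁻¹ * (localScalarCurvature g y
      - 2 * ((n : ℝ) - 1) * endTrace (gradDeriv g φ y)
      - ((n : ℝ) - 2) * ((n : ℝ) - 1) * gradSq g φ y) := by
  have nd := hg.nondeg y hy
  have t : metricTrace (g y) (fun v w => fderiv ℝ φ y v * fderiv ℝ φ y w) = gradSq g φ y := by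
    have := nd.metricTrace_tensor_left (hg.symm y hy) (grad g φ y) (fderiv ℝ φ y)
    simpa only [hg.apply_grad hy, smul_eq_mul, gradSq] using this
  rw [(hc.isMetricOn hg hφ).localScalarCurvature_eq hy, hc y hy,
    nd.metricTrace_smul_metric (Real.exp_pos _).ne', hg.localScalarCurvature_eq hy, smul_eq_mul]
  congr 1
  simp only [hc.ricciMap_apply hg hφ hy, metricTrace_add, metricTrace_mul_left]
  rw [hg.metricTrace_hessianMap hφ hy, t, nd.metricTrace_self]
  ring

theorem IsConformalOn.localLaplacian_eq (hg : IsMetricOn g U) (hφ : ContDiffOn ℝ ∞ φ U)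
    (hc : IsConformalOn h g φ U) (hy : y ∈ U) (p : Model n → ℂ) :
    localLaplacian h p y = ((Real.exp (2 * φ y))⁻¹ : ℝ) * (localLaplacian g p y
      + ((n : ℂ) - 2) * fderiv ℝ p y (grad g φ y)) := by
  have nd := hg.nondeg y hy
  -- The corrections are written as tensors whose metric traces are known: the two mixed terms
  -- contribute -2 dp(∇φ), the last one n dp(∇φ).
  have e : ∀ u v, hessianMap h p y u v = hessianMap g p y u v
      + -1 * (g y (grad g φ y) u • fderiv ℝ p y v)
      + -1 * (g y (grad g φ y) v • fderiv ℝ p y u)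
      + (g y u v : ℂ) * fderiv ℝ p y (grad g φ y) := by
    intro u v
    rw [hessianMap_apply, ← christoffelMap_apply h, hc.christoffelMap hg hφ hy]
    simp only [_root_.add_apply, conformalDifference_apply, christoffelMap_apply,
      hg.apply_grad hy, map_add, map_sub, map_smul, hessianMap_apply, Complex.real_smul]
    ring
  rw [ConformalGeometry.localLaplacian_eq, ConformalGeometry.localLaplacian_eq, hc y hy,
    nd.metricTrace_smul_metric (Real.exp_pos _).ne', Complex.real_smul]
  congr 1
  simp only [e, metricTrace_add, metricTrace_mul_left, metricTrace_mul_right, metricTrace_ofReal,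
    nd.metricTrace_tensor_left (hg.symm y hy), nd.metricTrace_tensor_right, nd.metricTrace_self]
  push_cast
  ring

theorem IsMetricOn.localLaplacian_exp_mul (hg : IsMetricOn g U) (hφ : ContDiffOn ℝ ∞ φ U)
    (hy : y ∈ U) {p : Model n → ℂ} (hp : ContDiffOn ℝ ∞ p U) (μ : ℂ) :
    localLaplacian g (fun z => Complex.exp (φ z * μ) * p z) y
      = Complex.exp (φ y * μ) * (localLaplacian g p y + 2 * μ * fderiv ℝ p y (grad g φ y)
        + (μ * endTrace (gradDeriv g φ y) + μ ^ 2 * gradSq g φ y) * p y) := by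
  have nd := hg.nondeg y hy
  have dφ : ∀ z ∈ U, HasFDerivAt φ (fderiv ℝ φ z) z := fun z hz =>
    ((hφ.contDiffAt (hg.isOpen.mem_nhds hz)).differentiableAt (by simp)).hasFDerivAt
  have dp : ∀ z ∈ U, HasFDerivAt p (fderiv ℝ p z) z := fun z hz =>
    ((hp.contDiffAt (hg.isOpen.mem_nhds hz)).differentiableAt (by simp)).hasFDerivAt
  have dq : ∀ z ∈ U, HasFDerivAt (fun z => Complex.exp (φ z * μ))
      (Complex.exp (φ z * μ) • (Complex.ofRealCLM ∘L fderiv ℝ φ z).smulRight μ) z := by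
    intro z hz
    have h₁ := (Complex.ofRealCLM.hasFDerivAt (x := φ z)).comp z (dφ z hz)
    have h₂ := (h₁.mul_const μ).cexp
    refine h₂.congr_fderiv ?_
    ext u
    simp [mul_comm]
  have d₁ : ∀ v, ∀ z ∈ U, fderiv ℝ (fun z => Complex.exp (φ z * μ) * p z) z v
      = Complex.exp (φ z * μ) * (fderiv ℝ p z v + fderiv ℝ φ z v * μ * p z) := by
    intro v z hz
    refine (congrArg (fun l => l v) ((dq z hz).mul (dp z hz)).fderiv).trans ?_
    simp
    ring
  have cq : ContDiffOn ℝ ∞ (fun z => Complex.exp (φ z * μ) * p z) U :=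
    (((Complex.ofRealCLM.contDiff.comp_contDiffOn hφ).mul contDiffOn_const).cexp).mul hp
  have d₂ : ∀ u v, fderiv ℝ (fderiv ℝ (fun z => Complex.exp (φ z * μ) * p z)) y u v
      = Complex.exp (φ y * μ) * (fderiv ℝ φ y u * μ * (fderiv ℝ p y v + fderiv ℝ φ y v * μ * p y)
        + fderiv ℝ (fderiv ℝ p) y u v + fderiv ℝ (fderiv ℝ φ) y u v * μ * p y
        + fderiv ℝ φ y v * μ * fderiv ℝ p y u) := by
    intro u v
    have h₁ := (hasFDerivAt_fderiv_of_contDiffOn hg.isOpen cq hy).clm_apply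
      (hasFDerivAt_const v y)
    have ha := (hasFDerivAt_fderiv_of_contDiffOn hg.isOpen hφ hy).clm_apply
      (hasFDerivAt_const v y)
    have hb := (hasFDerivAt_fderiv_of_contDiffOn hg.isOpen hp hy).clm_apply
      (hasFDerivAt_const v y)
    have hc := ((Complex.ofRealCLM.hasFDerivAt (x := fderiv ℝ φ y v)).comp y ha)
    have h₂ := (dq y hy).mul (hb.add ((hc.mul_const μ).mul (dp y hy)))
    have := congrArg (fun l => l u) (h₁.unique (h₂.congr_of_eventuallyEq
      (Filter.eventually_of_mem (hg.isOpen.mem_nhds hy) (d₁ v))))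
    simp at this
    rw [this]
    ring
  have e : ∀ u v, hessianMap g (fun z => Complex.exp (φ z * μ) * p z) y u v
      = Complex.exp (φ y * μ) * (hessianMap g p y u v
        + μ * (g y (grad g φ y) u • fderiv ℝ p y v)
        + μ * (g y (grad g φ y) v • fderiv ℝ p y u)
        + ((hessianMap g φ y u v : ℝ) : ℂ) * (μ * p y)
        + ((g y (grad g φ y) u • fderiv ℝ φ y v : ℝ) : ℂ) * (μ ^ 2 * p y)) := by
    intro u v
    rw [hessianMap_apply, d₂, d₁ _ y hy, hessianMap_apply, hessianMap_apply]
    simp only [hg.apply_grad hy, Complex.real_smul, smul_eq_mul]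
    push_cast
    ring
  rw [ConformalGeometry.localLaplacian_eq, ConformalGeometry.localLaplacian_eq]
  simp only [e, metricTrace_add, metricTrace_mul_left, metricTrace_mul_right, metricTrace_ofReal,
    nd.metricTrace_tensor_left (hg.symm y hy), nd.metricTrace_tensor_right,
    hg.metricTrace_hessianMap hφ hy]
  rw [gradSq]
  ring

/-- The Yamabe operator of a metric on an open subset of `ℝⁿ`. -/
def localYamabe (g : Model n → Model n →L[ℝ] Model n →L[ℝ] ℝ) (f : Model n → ℂ) (y : Model n) :
    ℂ :=
  localLaplacian g f y
    - (((n : ℝ) - 2) / (4 * ((n : ℝ) - 1)) * localScalarCurvature g y : ℝ) * f y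

theorem localYamabe_congr {f₁ f₂ : Model n → ℂ} (e : f₁ =ᶠ[nhds y] f₂) :
    localYamabe g f₁ y = localYamabe g f₂ y := by
  have h : hessian g f₁ y = hessian g f₂ y := by
    funext u v
    rw [hessian, hessian, e.fderiv.fderiv_eq, e.fderiv_eq]
  rw [localYamabe, localYamabe, localLaplacian, localLaplacian, h, e.self_of_nhds]

/-- With μ = (n-2)/2 the first-order terms agree since 2μ = n-2. The curvature coefficient
(n-2)/(4(n-1)) turns -2(n-1) Δφ and -(n-2)(n-1) |∇φ|² into -μ Δφ and -μ² |∇φ|², as required.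
Dividing by n-1 is where n ≠ 1 enters. -/
theorem IsConformalOn.localYamabe_eq (hn : (n : ℝ) ≠ 1) (hg : IsMetricOn g U)
    (hφ : ContDiffOn ℝ ∞ φ U) (hc : IsConformalOn h g φ U) (hy : y ∈ U) {p : Model n → ℂ}
    (hp : ContDiffOn ℝ ∞ p U) :
    localYamabe g (fun z => Complex.exp (φ z * (((n : ℂ) - 2) / 2)) * p z) y
      = Complex.exp (φ y * (((n : ℂ) - 2) / 2)) * (Real.exp (2 * φ y) : ℝ)
        * localYamabe h p y := by
  rw [localYamabe, localYamabe, hg.localLaplacian_exp_mul hφ hy hp, hc.localLaplacian_eq hg hφ hy,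
    hc.localScalarCurvature_eq hg hφ hy]
  have h₁ : ((Real.exp (2 * φ y) : ℝ) : ℂ) ≠ 0 := by exact_mod_cast (Real.exp_pos _).ne'
  have h₂ : (n : ℂ) - 1 ≠ 0 := by
    rw [sub_ne_zero]
    exact_mod_cast hn
  generalize Real.exp (2 * φ y) = E at *
  push_cast
  field_simp
  ring

/-- The map factors through the intermediate metric Ω² g: a conformal change on the domain followed
by a local isometry. The scalar is left unspecified because only the vanishing of the operator is
transported. -/
theorem localYamabe_covariant {g' : Model n → Model n →L[ℝ] Model n →L[ℝ] ℝ}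
    {V : Set (Model n)} {F : Model n → Model n} {Ω : Model n → ℝ} (hn : (n : ℝ) ≠ 1)
    (hg : IsMetricOn g U) (hg' : IsMetricOn g' V) (hF : IsLocalDiffeoOn F U V)
    (hΩ : ContDiffOn ℝ ∞ Ω U) (pos : ∀ z ∈ U, 0 < Ω z)
    (hc : ∀ z ∈ U, ∀ u v, g' (F z) (fderiv ℝ F z u) (fderiv ℝ F z v) = Ω z ^ 2 * g z u v)
    {f : Model n → ℂ} (hf : ContDiffOn ℝ ∞ f V) (hy : y ∈ U) :
    ∃ c : ℂ, localYamabe g (fun z => (Ω z : ℂ) ^ (((n : ℂ) - 2) / 2) * f (F z)) y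
      = c * localYamabe g' f (F y) := by
  set φ : Model n → ℝ := fun z => Real.log (Ω z) with hφd
  have hφ : ContDiffOn ℝ ∞ φ U := hΩ.log fun z hz => (pos z hz).ne'
  set h : Model n → Model n →L[ℝ] Model n →L[ℝ] ℝ := fun z => Real.exp (2 * φ z) • g z with hh
  have hcf : IsConformalOn h g φ U := fun _ _ => rfl
  have hm := hcf.isMetricOn hg hφ
  have hp : IsPullbackOn h g' F U := by
    intro z hz u v
    rw [hc z hz, hh, hφd]
    simp only [_root_.smul_apply, smul_eq_mul]
    rw [two_mul, Real.exp_add, Real.exp_log (pos z hz), sq]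
  have e : (fun z => (Ω z : ℂ) ^ (((n : ℂ) - 2) / 2) * f (F z)) =ᶠ[nhds y]
      fun z => Complex.exp (φ z * (((n : ℂ) - 2) / 2)) * (f ∘ F) z := by
    filter_upwards [hg.isOpen.mem_nhds hy] with z hz
    rw [Complex.cpow_def_of_ne_zero (by exact_mod_cast (pos z hz).ne'),
      ← Complex.ofReal_log (pos z hz).le]
    rfl
  refine ⟨_, (localYamabe_congr e).trans ((hcf.localYamabe_eq hn hg hφ hy
    (hf.comp hF.contDiffOn hF.mapsTo)).trans (congrArg _ ?_))⟩
  rw [localYamabe, localYamabe, hp.localLaplacian_eq hF hg' hm hy hf,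
    hp.localScalarCurvature_eq hF hg' hm hy]
  rfl

end Conformal

/-! ### Passage from charts to manifolds -/

section Charts

variable {n : ℕ}
  {M : Type*} [TopologicalSpace M] [ChartedSpace (Model n) M] [IsManifold (𝓡 n) ∞ M]
  {N : Type*} [TopologicalSpace N] [ChartedSpace (Model n) N] [IsManifold (𝓡 n) ∞ N]
  {P : Type*} [TopologicalSpace P] [ChartedSpace (Model n) P] [IsManifold (𝓡 n) ∞ P]

/-- The bilinear form of a metric at a point, on the model space. -/
def PseudoRiemannianMetric.form (g : PseudoRiemannianMetric n M) (x : M) :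
    Model n →L[ℝ] Model n →L[ℝ] ℝ := g.val x

/-- The derivative of a map between manifolds, on the model space. -/
def modelDeriv {M : Type*} [TopologicalSpace M] [ChartedSpace (Model n) M]
    {N : Type*} [TopologicalSpace N] [ChartedSpace (Model n) N] (f : M → N) (x : M) :
    Model n →L[ℝ] Model n := mfderiv (𝓡 n) (𝓡 n) f x

section
variable {M : Type*} [TopologicalSpace M] [ChartedSpace (Model n) M]
  {N : Type*} [TopologicalSpace N] [ChartedSpace (Model n) N]
  {P : Type*} [TopologicalSpace P] [ChartedSpace (Model n) P]

theorem modelDeriv_comp_apply {f : M → N} {k : N → P} {x : M}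
    (hk : MDifferentiableAt (𝓡 n) (𝓡 n) k (f x)) (hf : MDifferentiableAt (𝓡 n) (𝓡 n) f x)
    (u : Model n) : modelDeriv (k ∘ f) x u = modelDeriv k (f x) (modelDeriv f x u) :=
  congrArg (fun T : Model n →L[ℝ] Model n => T u) (mfderiv_comp x hk hf)

theorem modelDeriv_congr {f k : M → N} {x : M} (h : f =ᶠ[nhds x] k) :
    modelDeriv (n := n) f x = modelDeriv k x := h.mfderiv_eq

theorem modelDeriv_id (x : M) : modelDeriv (id : M → M) x = ContinuousLinearMap.id ℝ (Model n) :=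
  mfderiv_id

theorem modelDeriv_eq_fderiv (f : Model n → Model n) (x : Model n) :
    modelDeriv f x = fderiv ℝ f x := mfderiv_eq_fderiv

end

/-- Tangent spaces are definitionally the model space; this form lets the chain rule and linear
algebra be carried out there. -/
theorem isConformalFactor_iff {gM : PseudoRiemannianMetric n M} {gN : PseudoRiemannianMetric n N}
    {Φ : M → N} {Ω : M → ℝ} : IsConformalFactor gM gN Φ Ω ↔ (∀ x, 0 < Ω x) ∧
      ∀ x u v, gN.form (Φ x) (modelDeriv Φ x u) (modelDeriv Φ x v) = Ω x ^ 2 * gM.form x u v :=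
  Iff.rfl

theorem IsConformalFactor.comp {gM : PseudoRiemannianMetric n M}
    {gN : PseudoRiemannianMetric n N} {gP : PseudoRiemannianMetric n P} {Φ : M → N} {Ψ : N → P}
    {Ω : M → ℝ} {Ω' : N → ℝ} (h' : IsConformalFactor gN gP Ψ Ω')
    (h : IsConformalFactor gM gN Φ Ω) (dΨ : MDifferentiable (𝓡 n) (𝓡 n) Ψ)
    (dΦ : MDifferentiable (𝓡 n) (𝓡 n) Φ) :
    IsConformalFactor gM gP (Ψ ∘ Φ) (fun x => Ω' (Φ x) * Ω x) := by
  rw [isConformalFactor_iff] at *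
  refine ⟨fun x => mul_pos (h'.1 _) (h.1 _), fun x u v => ?_⟩
  rw [modelDeriv_comp_apply (dΨ _) (dΦ _), modelDeriv_comp_apply (dΨ _) (dΦ _),
    Function.comp_apply, h'.2, h.2]
  ring

theorem mdifferentiableAt_extChartAt_symm (x : M) {y : Model n}
    (hy : y ∈ (extChartAt (𝓡 n) x).target) :
    MDifferentiableAt (𝓡 n) (𝓡 n) (extChartAt (𝓡 n) x).symm y :=
  (((contMDiffOn_extChartAt_symm (n := ∞) x).contMDiffAt
    ((isOpen_extChartAt_target x).mem_nhds hy))).mdifferentiableAt (by simp)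

theorem mdifferentiableAt_extChartAt' (x : M) {z : M} (hz : z ∈ (extChartAt (𝓡 n) x).source) :
    MDifferentiableAt (𝓡 n) (𝓡 n) (extChartAt (𝓡 n) x) z :=
  (contMDiffAt_extChartAt' (n := ∞) (by simpa using hz)).mdifferentiableAt (by simp)

theorem PseudoRiemannianMetric.inChart_apply (g : PseudoRiemannianMetric n M) (x : M)
    (y u v : Model n) : g.inChart x y u v = g.form ((extChartAt (𝓡 n) x).symm y)
      (modelDeriv (extChartAt (𝓡 n) x).symm y u) (modelDeriv (extChartAt (𝓡 n) x).symm y v) := rfl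

/-- The field is the image of a constant section under the tangent map of the inverse chart, which
is smooth. -/
theorem contMDiffAt_modelDeriv_extChartAt_symm (x : M) {y : Model n}
    (hy : y ∈ (extChartAt (𝓡 n) x).target) (u : Model n) :
    ContMDiffAt (𝓡 n) ((𝓡 n).prod 𝓘(ℝ, Model n)) ∞
      (fun z => Bundle.TotalSpace.mk' (Model n) (E := fun x : M => TangentSpace (𝓡 n) x)
        ((extChartAt (𝓡 n) x).symm z) (modelDeriv (extChartAt (𝓡 n) x).symm z u)) y := by
  have hO := isOpen_extChartAt_target (I := 𝓡 n) x
  have t := (contMDiffOn_extChartAt_symm (I := 𝓡 n) (n := ∞) x).contMDiffOn_tangentMapWithin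
    (m := ∞) (by simp) hO.uniqueMDiffOn
  have s : ContMDiffAt (𝓡 n) ((𝓡 n).prod 𝓘(ℝ, Model n)) ∞
      (fun z => Bundle.TotalSpace.mk' (Model n) (E := fun x : Model n => TangentSpace (𝓡 n) x)
        z u) y := contMDiffAt_vectorSpace_iff_contDiffAt.2 contDiffAt_const
  have c := (t.contMDiffAt (x := (⟨y, u⟩ : TangentBundle (𝓡 n) (Model n))) ?_).comp y s
  · refine c.congr_of_eventuallyEq ?_
    filter_upwards [hO.mem_nhds hy] with z hz
    simp only [Function.comp_apply, tangentMapWithin, Bundle.TotalSpace.mk']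
    rw [mfderivWithin_of_isOpen hO hz]
    rfl
  · exact (FiberBundle.continuous_proj (Model n)
      (fun x : Model n => TangentSpace (𝓡 n) x)).continuousAt.preimage_mem_nhds (hO.mem_nhds hy)

theorem PseudoRiemannianMetric.isMetricOn_inChart (g : PseudoRiemannianMetric n M) (x : M) :
    IsMetricOn (g.inChart x) (extChartAt (𝓡 n) x).target where
  isOpen := isOpen_extChartAt_target x
  symm z _ u v := g.symm _ _ _
  nondeg z hz u hu := by
    have e : ∀ w : Model n, modelDeriv (extChartAt (𝓡 n) x) ((extChartAt (𝓡 n) x).symm z)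
        (modelDeriv (extChartAt (𝓡 n) x).symm z w) = w := by
      intro w
      have hs := mdifferentiableAt_extChartAt_symm x hz
      have hc := mdifferentiableAt_extChartAt' x ((extChartAt (𝓡 n) x).map_target hz)
      rw [← modelDeriv_comp_apply hc hs, modelDeriv_congr (k := id), modelDeriv_id]
      · rfl
      · filter_upwards [(isOpen_extChartAt_target x).mem_nhds hz] with y hy
        exact (extChartAt (𝓡 n) x).right_inv hy
    -- In finite dimension a one-sided inverse is two-sided: the identity above makes the derivative
    -- injective, hence onto.
    have e' : ∀ w : Model n, modelDeriv (extChartAt (𝓡 n) x).symm z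
        (modelDeriv (extChartAt (𝓡 n) x) ((extChartAt (𝓡 n) x).symm z) w) = w := by
      intro w
      have inj : Function.Injective (modelDeriv (extChartAt (𝓡 n) x).symm z).toLinearMap :=
        Function.LeftInverse.injective e
      obtain ⟨w, rfl⟩ := LinearMap.injective_iff_surjective.1 inj w
      exact congrArg _ (e w)
    have h0 : modelDeriv (extChartAt (𝓡 n) x).symm z u = 0 := by
      refine g.nondegenerate ((extChartAt (𝓡 n) x).symm z) _ fun (v : Model n) => ?_
      have := hu (modelDeriv (extChartAt (𝓡 n) x) ((extChartAt (𝓡 n) x).symm z) v)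
      rw [g.inChart_apply, e'] at this
      exact this
    rw [← e u, h0, map_zero]
  contDiffOn := by
    rw [contDiffOn_clm_apply]
    intro u
    rw [contDiffOn_clm_apply]
    intro v z hz
    have sg := (g.contMDiff ((extChartAt (𝓡 n) x).symm z)).comp z
      ((contMDiffOn_extChartAt_symm (n := ∞) x).contMDiffAt
        ((isOpen_extChartAt_target x).mem_nhds hz))
    have := ContMDiffAt.clm_bundle_apply₂ (F₁ := Model n) (F₂ := Model n) (F₃ := ℝ)
      (E₃ := Bundle.Trivial M ℝ) sg (contMDiffAt_modelDeriv_extChartAt_symm x hz u)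
      (contMDiffAt_modelDeriv_extChartAt_symm x hz v)
    simp only [Bundle.contMDiffAt_totalSpace] at this
    exact this.2.contDiffAt.contDiffWithinAt

theorem contDiffOn_comp_extChartAt_symm {F : Type*} [NormedAddCommGroup F] [NormedSpace ℝ F]
    {f : M → F} (hf : ContMDiff (𝓡 n) 𝓘(ℝ, F) ∞ f) (x : M) :
    ContDiffOn ℝ ∞ (f ∘ (extChartAt (𝓡 n) x).symm) (extChartAt (𝓡 n) x).target :=
  (hf.comp_contMDiffOn (contMDiffOn_extChartAt_symm x)).contDiffOn

section
variable {M : Type*} [TopologicalSpace M] [ChartedSpace (Model n) M]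
  {N : Type*} [TopologicalSpace N] [ChartedSpace (Model n) N]

/-- A map between manifolds in the preferred charts at `x` and at its image. -/
def inCharts (Φ : M → N) (x : M) :
    Model n → Model n :=
  extChartAt (𝓡 n) (Φ x) ∘ Φ ∘ (extChartAt (𝓡 n) x).symm

/-- The domain of a map in the preferred charts. -/
def inChartsDomain (Φ : M → N) (x : M) :
    Set (Model n) :=
  (extChartAt (𝓡 n) x).target
    ∩ (Φ ∘ (extChartAt (𝓡 n) x).symm) ⁻¹' (extChartAt (𝓡 n) (Φ x)).source

theorem isOpen_inChartsDomain {Φ : M → N} (hΦ : Continuous Φ) (x : M) :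
    IsOpen (inChartsDomain (n := n) Φ x) :=
  (hΦ.comp_continuousOn (continuousOn_extChartAt_symm x)).isOpen_inter_preimage
    (isOpen_extChartAt_target x) (isOpen_extChartAt_source (Φ x))

end

theorem form_inCharts {gM : PseudoRiemannianMetric n M} {gN : PseudoRiemannianMetric n N}
    {Φ : M → N} (hΦ : ContMDiff (𝓡 n) (𝓡 n) ∞ Φ) {Ω : M → ℝ} (h : IsConformalFactor gM gN Φ Ω)
    (x : M) {z : Model n} (hz : z ∈ inChartsDomain (n := n) Φ x) (u v : Model n) :
    gN.inChart (Φ x) (inCharts Φ x z) (fderiv ℝ (inCharts Φ x) z u) (fderiv ℝ (inCharts Φ x) z v)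
      = Ω ((extChartAt (𝓡 n) x).symm z) ^ 2 * gM.inChart x z u v := by
  have dΦ := hΦ.mdifferentiable (by simp)
  have ds := mdifferentiableAt_extChartAt_symm x hz.1
  have dF : MDifferentiableAt (𝓡 n) (𝓡 n) (inCharts Φ x) z :=
    (mdifferentiableAt_extChartAt' (Φ x) hz.2).comp z ((dΦ _).comp z ds)
  have ht : inCharts Φ x z ∈ (extChartAt (𝓡 n) (Φ x)).target :=
    (extChartAt (𝓡 n) (Φ x)).map_source hz.2
  -- Near z the target chart and its inverse cancel, so the chain rule reduces the derivative in
  -- charts to that of Φ.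
  have ev : (extChartAt (𝓡 n) (Φ x)).symm ∘ inCharts Φ x
      =ᶠ[nhds z] Φ ∘ (extChartAt (𝓡 n) x).symm := by
    filter_upwards [(isOpen_inChartsDomain hΦ.continuous x).mem_nhds hz] with w hw
    exact (extChartAt (𝓡 n) (Φ x)).left_inv hw.2
  have e : ∀ w : Model n, modelDeriv (extChartAt (𝓡 n) (Φ x)).symm (inCharts Φ x z)
      (fderiv ℝ (inCharts Φ x) z w)
      = modelDeriv Φ ((extChartAt (𝓡 n) x).symm z) (modelDeriv (extChartAt (𝓡 n) x).symm z w) := by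
    intro w
    rw [← modelDeriv_eq_fderiv, ← modelDeriv_comp_apply
      (mdifferentiableAt_extChartAt_symm (Φ x) ht) dF, modelDeriv_congr ev,
      modelDeriv_comp_apply (dΦ _) ds]
  rw [gN.inChart_apply, e, e, gM.inChart_apply, ← (isConformalFactor_iff.1 h).2]
  exact congrArg (fun p => gN.form p _ _) ev.self_of_nhds

theorem isLocalDiffeoOn_inCharts {gM : PseudoRiemannianMetric n M}
    {gN : PseudoRiemannianMetric n N} {Φ : M → N} (hΦ : ContMDiff (𝓡 n) (𝓡 n) ∞ Φ) {Ω : M → ℝ}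
    (h : IsConformalFactor gM gN Φ Ω) (x : M) :
    IsLocalDiffeoOn (inCharts Φ x) (inChartsDomain (n := n) Φ x)
      (extChartAt (𝓡 n) (Φ x)).target where
  isOpen := isOpen_inChartsDomain hΦ.continuous x
  mapsTo z hz := (extChartAt (𝓡 n) (Φ x)).map_source hz.2
  contDiffOn := by
    have h₁ : ContMDiffOn (𝓡 n) (𝓡 n) ∞ (extChartAt (𝓡 n) (Φ x))
        (extChartAt (𝓡 n) (Φ x)).source := by
      rw [extChartAt_source]
      exact contMDiffOn_extChartAt
    exact (h₁.comp (hΦ.comp_contMDiffOn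
      ((contMDiffOn_extChartAt_symm x).mono Set.inter_subset_left))
      fun z hz => hz.2).contDiffOn
  isInvertible z hz := by
    -- A vector killed by the derivative is orthogonal to everything for Ω² times the source metric,
    -- hence zero.
    have inj : Function.Injective (fderiv ℝ (inCharts Φ x) z).toLinearMap := by
      rw [← LinearMap.ker_eq_bot, LinearMap.ker_eq_bot']
      intro u hu
      refine (gM.isMetricOn_inChart x).nondeg z hz.1 u fun v => ?_
      have := form_inCharts hΦ h x hz u v
      rw [show fderiv ℝ (inCharts Φ x) z u = 0 from hu] at this
      simpa [(h.1 _).ne'] using this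
    refine ⟨(LinearEquiv.ofInjectiveEndo _ inj).toContinuousLinearEquiv, ?_⟩
    ext1 u
    rfl

theorem yamabe_apply (g : PseudoRiemannianMetric n M) (f : smoothFunctions n M) (x : M) :
    yamabe g f x = localYamabe (g.inChart x) ((f : M → ℂ) ∘ (extChartAt (𝓡 n) x).symm)
      (extChartAt (𝓡 n) x x) := by
  simp only [localYamabe, Function.comp_apply, extChartAt_to_inv]
  rfl

theorem twistedPullback_apply [NeZero n] {gM : PseudoRiemannianMetric n M}
    {gN : PseudoRiemannianMetric n N} {Φ : M → N} (hΦ : IsConformalMap gM gN Φ) (lam : ℂ)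
    (f : smoothFunctions n N) (x : M) : (twistedPullback hΦ lam f : M → ℂ) x
      = (hΦ.factor x : ℂ) ^ lam * (f : N → ℂ) (Φ x) := rfl

/-- Conformal covariance of the Yamabe operator. -/
theorem yamabe_twistedPullback [NeZero n] (hn : n ≠ 1) {gM : PseudoRiemannianMetric n M}
    {gN : PseudoRiemannianMetric n N} {Φ : M → N} (hΦ : IsConformalMap gM gN Φ)
    (f : smoothFunctions n N) (x : M) :
    ∃ c : ℂ, yamabe gM (twistedPullback hΦ (((n : ℂ) - 2) / 2) f) x = c * yamabe gN f (Φ x) := by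
  have sΦ := hΦ.isLocalDiffeomorph.contMDiff
  have hf := hΦ.isConformalFactor
  have hy : extChartAt (𝓡 n) x x ∈ inChartsDomain (n := n) Φ x := by
    refine ⟨mem_extChartAt_target x, ?_⟩
    rw [Set.mem_preimage, Function.comp_apply, extChartAt_to_inv]
    exact mem_extChartAt_source (Φ x)
  have hF := isLocalDiffeoOn_inCharts sΦ hf x
  have hM := gM.isMetricOn_inChart x
  obtain ⟨c, hc⟩ := localYamabe_covariant (by exact_mod_cast hn)
    -- The source metric is restricted to the part of the chart that Φ maps into the target chart.
    ⟨hF.isOpen, fun z hz => hM.symm z hz.1, fun z hz => hM.nondeg z hz.1,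
      hM.contDiffOn.mono Set.inter_subset_left⟩ (gN.isMetricOn_inChart (Φ x)) hF
    ((contDiffOn_comp_extChartAt_symm (hf.contMDiff sΦ) x).mono Set.inter_subset_left)
    (fun z _ => hf.1 _) (fun z hz u v => form_inCharts sΦ hf x hz u v)
    (contDiffOn_comp_extChartAt_symm f.2 (Φ x)) hy
  refine ⟨c, ?_⟩
  have eF : inCharts Φ x (extChartAt (𝓡 n) x x) = extChartAt (𝓡 n) (Φ x) (Φ x) := by
    simp [inCharts]
  rw [yamabe_apply, yamabe_apply, ← eF, ← hc]
  refine localYamabe_congr ?_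
  filter_upwards [hF.isOpen.mem_nhds hy] with z hz
  simp only [Function.comp_apply, inCharts]
  rw [twistedPullback_apply]
  exact congrArg (fun p => _ * (f : N → ℂ) p) ((extChartAt (𝓡 n) (Φ x)).left_inv hz.2).symm

theorem mapsTo_twistedPullback_yamabeKer [NeZero n] (hn : n ≠ 1)
    {gM : PseudoRiemannianMetric n M} {gN : PseudoRiemannianMetric n N} {Φ : M → N}
    (hΦ : IsConformalMap gM gN Φ) :
    Set.MapsTo (twistedPullback hΦ (((n : ℂ) - 2) / 2)) (yamabeKer gN) (yamabeKer gM) := by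
  intro f hf
  have h : yamabe gN f = 0 := hf
  change yamabe gM _ = 0
  funext x
  obtain ⟨c, hc⟩ := yamabe_twistedPullback hn hΦ f x
  rw [hc, h]
  simp

theorem IsConformalMap.mdifferentiable {gM : PseudoRiemannianMetric n M}
    {gN : PseudoRiemannianMetric n N} {Φ : M → N} (hΦ : IsConformalMap gM gN Φ) :
    MDifferentiable (𝓡 n) (𝓡 n) Φ :=
  hΦ.isLocalDiffeomorph.mdifferentiable (by simp)

/-- Both products are conformal factors of the same composite map, and such a factor is unique. -/
theorem IsConformalMap.factor_comp_eq [NeZero n] {gM : PseudoRiemannianMetric n M}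
    {gP : PseudoRiemannianMetric n P} {N' : Type*} [TopologicalSpace N']
    [ChartedSpace (Model n) N'] [IsManifold (𝓡 n) ∞ N'] {gN : PseudoRiemannianMetric n N}
    {gN' : PseudoRiemannianMetric n N'} {Φ : M → N} {Ψ : N → P} {Φ' : M → N'} {Ψ' : N' → P}
    (hΦ : IsConformalMap gM gN Φ) (hΨ : IsConformalMap gN gP Ψ) (hΦ' : IsConformalMap gM gN' Φ')
    (hΨ' : IsConformalMap gN' gP Ψ') (e : Ψ ∘ Φ = Ψ' ∘ Φ') (x : M) :
    hΨ.factor (Φ x) * hΦ.factor x = hΨ'.factor (Φ' x) * hΦ'.factor x := by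
  have h₁ := hΨ.isConformalFactor.comp hΦ.isConformalFactor hΨ.mdifferentiable hΦ.mdifferentiable
  have h₂ := hΨ'.isConformalFactor.comp hΦ'.isConformalFactor hΨ'.mdifferentiable
    hΦ'.mdifferentiable
  rw [e] at h₁
  exact congrFun (h₁.unique h₂) x

theorem isConformalFactor_id (g : PseudoRiemannianMetric n M) :
    IsConformalFactor g g id (fun _ => 1) := by
  refine isConformalFactor_iff.2 ⟨fun _ => one_pos, fun x u v => ?_⟩
  rw [modelDeriv_id]
  simp

theorem IsConformalFactor.symm {gM : PseudoRiemannianMetric n M}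
    {gN : PseudoRiemannianMetric n N} {Ω : M → ℝ} (Ψ : M ≃ₘ⟮𝓡 n, 𝓡 n⟯ N)
    (h : IsConformalFactor gM gN Ψ Ω) :
    IsConformalFactor gN gM Ψ.symm (fun y => (Ω (Ψ.symm y))⁻¹) := by
  rw [isConformalFactor_iff] at *
  refine ⟨fun y => inv_pos.2 (h.1 _), fun y u v => ?_⟩
  have e : ∀ w : Model n, modelDeriv Ψ (Ψ.symm y) (modelDeriv Ψ.symm y w) = w := by
    intro w
    rw [← modelDeriv_comp_apply (Ψ.mdifferentiable (by simp) _)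
      (Ψ.symm.mdifferentiable (by simp) _), show (Ψ ∘ Ψ.symm : N → N) = id from
        funext Ψ.apply_symm_apply, modelDeriv_id]
    rfl
  have := h.2 (Ψ.symm y) (modelDeriv Ψ.symm y u) (modelDeriv Ψ.symm y v)
  rw [e, e, Ψ.apply_symm_apply] at this
  rw [this, ← mul_assoc, ← mul_pow, inv_mul_cancel₀ (h.1 _).ne', one_pow, one_mul]

theorem IsConformalMap.symm {gM : PseudoRiemannianMetric n M}
    {gN : PseudoRiemannianMetric n N} (Ψ : M ≃ₘ⟮𝓡 n, 𝓡 n⟯ N) (h : IsConformalMap gM gN Ψ) :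
    IsConformalMap gN gM Ψ.symm :=
  ⟨Ψ.symm.isLocalDiffeomorph, _, h.isConformalFactor.symm Ψ⟩

/-- The product of the two factors is a conformal factor of the identity, hence 1; so is the product
of their complex powers, both factors being positive. -/
theorem twistedPullback_comp_eq_id [NeZero n] {gM : PseudoRiemannianMetric n M}
    {gN : PseudoRiemannianMetric n N} {Φ : M → N} {Ψ : N → M} (hΦ : IsConformalMap gM gN Φ)
    (hΨ : IsConformalMap gN gM Ψ) (e : Φ ∘ Ψ = id) (lam : ℂ) :
    twistedPullback hΨ lam ∘ₗ twistedPullback hΦ lam = LinearMap.id := by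
  ext f y
  have h := hΦ.isConformalFactor.comp hΨ.isConformalFactor hΦ.mdifferentiable hΨ.mdifferentiable
  rw [e] at h
  have h₁ : hΦ.factor (Ψ y) * hΨ.factor y = 1 := congrFun (h.unique (isConformalFactor_id gN)) y
  rw [LinearMap.comp_apply, twistedPullback_apply, twistedPullback_apply, ← mul_assoc, mul_comm
    ((hΨ.factor y : ℂ) ^ lam), ← Complex.mul_cpow_ofReal_nonneg (hΦ.isConformalFactor.1 _).le
      (hΨ.isConformalFactor.1 _).le, ← Complex.ofReal_mul, h₁,
      show Φ (Ψ y) = y from congrFun e y]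
  simp

end Charts

end ConformalGeometry

end

/-! ### The proposition -/

open ConformalGeometry in
theorem proposition2p6 {n : ℕ} [n.AtLeastTwo]
    {M : Type*} [TopologicalSpace M] [ChartedSpace (Model n) M] [IsManifold (𝓡 n) ∞ M]
    {N : Type*} [TopologicalSpace N] [ChartedSpace (Model n) N] [IsManifold (𝓡 n) ∞ N]
    (gM : PseudoRiemannianMetric n M) (gN : PseudoRiemannianMetric n N)
    (Φ : M → N) (hΦ : IsConformalMap gM gN Φ)
    {G' G : Type*} [Group G'] [Group G] [MulAction G' M] [MulAction G N]
    (hM : IsConformalAction G' gM) (hN : IsConformalAction G gN)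
    (i : G' →* G) (hi : ∀ (h : G') (x : M), i h • Φ x = Φ (h • x)) :
    -- compatibility of the conformal factors
    (∀ (h : G') (x : M),
      hΦ.factor (h • x) * hM.factor h x = hΦ.factor x * hN.factor (i h) (Φ x)) ∧
    -- the twisted pull-backs intertwine the representations
    (∀ (lam : ℂ) (h : G'),
      twistedPullback hΦ lam ∘ₗ varpi hN lam (i h) = varpi hM lam h ∘ₗ twistedPullback hΦ lam) ∧
    -- the critical twisted pull-back maps kernel to kernel, compatibly with the actions on kernels
    (Set.MapsTo (twistedPullback hΦ (((n : ℂ) - 2) / 2)) (yamabeKer gN) (yamabeKer gM) ∧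
      (∀ k : G, Set.MapsTo (varpi hN (((n : ℂ) - 2) / 2) k) (yamabeKer gN) (yamabeKer gN)) ∧
      (∀ h : G', Set.MapsTo (varpi hM (((n : ℂ) - 2) / 2) h) (yamabeKer gM) (yamabeKer gM)) ∧
      ∀ (h : G'), ∀ f ∈ yamabeKer gN,
        twistedPullback hΦ (((n : ℂ) - 2) / 2) (varpi hN (((n : ℂ) - 2) / 2) (i h) f)
          = varpi hM (((n : ℂ) - 2) / 2) h (twistedPullback hΦ (((n : ℂ) - 2) / 2) f)) ∧
    -- the case of a diffeomorphism
    (∀ Ψ : M ≃ₘ⟮𝓡 n, 𝓡 n⟯ N, (∀ x, Ψ x = Φ x) →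
      ∃ hΨ : IsConformalMap gN gM Ψ.symm,
        (∀ lam : ℂ,
          twistedPullback hΨ lam ∘ₗ twistedPullback hΦ lam = LinearMap.id ∧
          twistedPullback hΦ lam ∘ₗ twistedPullback hΨ lam = LinearMap.id) ∧
        Set.BijOn (twistedPullback hΦ (((n : ℂ) - 2) / 2)) (yamabeKer gN) (yamabeKer gM) ∧
        Set.BijOn (twistedPullback hΨ (((n : ℂ) - 2) / 2)) (yamabeKer gM) (yamabeKer gN) ∧
        Set.InvOn (twistedPullback hΨ (((n : ℂ) - 2) / 2)) (twistedPullback hΦ (((n : ℂ) - 2) / 2))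
          (yamabeKer gN) (yamabeKer gM)) := by
  have hn : n ≠ 1 := Nat.AtLeastTwo.ne_one
  have intertwine : ∀ (lam : ℂ) (h : G'),
      twistedPullback hΦ lam ∘ₗ varpi hN lam (i h)
        = varpi hM lam h ∘ₗ twistedPullback hΦ lam := by
    intro lam h
    ext f x
    -- The representation acts by twisted pull-back along the inverse element, so equivariance is
    -- needed for h⁻¹.
    have e : (fun y : N => (i h)⁻¹ • y) ∘ Φ = Φ ∘ fun x : M => h⁻¹ • x := by
      funext z
      simpa using hi h⁻¹ z
    have hf := hΦ.factor_comp_eq (hN (i h)⁻¹) (hM h⁻¹) hΦ e x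
    change (hΦ.factor x : ℂ) ^ lam * (((hN (i h)⁻¹).factor (Φ x) : ℂ) ^ lam
        * (f : N → ℂ) ((i h)⁻¹ • Φ x))
      = ((hM h⁻¹).factor x : ℂ) ^ lam * ((hΦ.factor (h⁻¹ • x) : ℂ) ^ lam
        * (f : N → ℂ) (Φ (h⁻¹ • x)))
    have p := hΦ.isConformalFactor.1
    rw [show (i h)⁻¹ • Φ x = Φ (h⁻¹ • x) from congrFun e x, ← mul_assoc, ← mul_assoc,
      ← Complex.mul_cpow_ofReal_nonneg (p x).le ((hN (i h)⁻¹).isConformalFactor.1 _).le,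
      ← Complex.mul_cpow_ofReal_nonneg ((hM h⁻¹).isConformalFactor.1 _).le (p _).le,
      ← Complex.ofReal_mul, ← Complex.ofReal_mul, mul_comm (hΦ.factor x), hf,
      mul_comm (hΦ.factor (h⁻¹ • x))]
  refine ⟨fun h x => ?_, intertwine, ⟨mapsTo_twistedPullback_yamabeKer hn hΦ,
    fun k => mapsTo_twistedPullback_yamabeKer hn (hN k⁻¹),
    fun h => mapsTo_twistedPullback_yamabeKer hn (hM h⁻¹),
    fun h f _ => congrArg (fun T => T f) (intertwine _ h)⟩, ?_⟩
  · rw [mul_comm (hΦ.factor x)]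
    -- The two composites Φ ∘ L_h and L_{i(h)} ∘ Φ coincide.
    exact (hM h).factor_comp_eq hΦ hΦ (hN (i h)) (funext fun z => (hi h z).symm) x
  · intro Ψ hΨ
    obtain rfl : ⇑Ψ = Φ := funext hΨ
    have hΨ' := hΦ.symm Ψ
    have inv₁ := twistedPullback_comp_eq_id hΦ hΨ' (funext Ψ.apply_symm_apply)
    have inv₂ := twistedPullback_comp_eq_id hΨ' hΦ (funext Ψ.symm_apply_apply)
    have m₁ := mapsTo_twistedPullback_yamabeKer hn hΦ
    have m₂ := mapsTo_twistedPullback_yamabeKer hn hΨ'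
    have inv : Set.InvOn (twistedPullback hΨ' (((n : ℂ) - 2) / 2))
        (twistedPullback hΦ (((n : ℂ) - 2) / 2)) (yamabeKer gN) (yamabeKer gM) :=
      ⟨fun f _ => congrArg (fun T => T f) (inv₁ _), fun f _ => congrArg (fun T => T f) (inv₂ _)⟩
    exact ⟨hΨ', fun lam => ⟨inv₁ lam, inv₂ lam⟩, inv.bijOn m₁ m₂, inv.symm.bijOn m₂ m₁, inv⟩
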